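/- Let $d\ge 2$ and $\gamma>d$. Let $\mu_d$ be the isometry-invariant measure on the lines of $\mathbb{R}^d$, normalized so that the set $[K]$ of lines hitting a convex body $K$ has measure $\mu_d([K])=\frac12 m_{d-1}(\partial K)$, where $m_{d-1}$ is $(d-1)$-dimensional area, and let $\Pi$ be a Poisson point process of marked lines $(l,v)$, $v>0$, with intensity $d\mu_d(l)\,(\gamma-1)v^{-\gamma}\,dv$. For a set $\Gamma$ of marked lines, a $\Gamma$-path from $x$ to $y$ with time $T(\xi)=T\in[0,\infty)$ is a locally Lipschitz map $\xi:[0,T]\to\mathbb{R}^d$ with $\xi(0)=x$, $\xi(T)=y$, such that for almost every $t$ either $\xi'(t)=0$ or $(\xi(t)+\mathbb{R}\xi'(t),v)\in\Gamma$ for some $v\ge|\xi'(t)|$. For a set of lines $\mathcal L$ let $\Pi_{\mathcal L}=\{(l,v)\in\Pi: l\in\mathcal L\}$. For $K\subset\mathbb{R}^d$ let $[K]$ be the set of lines hitting $K$, and let $A^{s}=A\oplus B(0,s)$ be the (open) $s$-widening of $A$. The solid angle of $F$ from $x$ is the proportion, for the uniform probability on directions, of the directions of lines through $x$ that hit $F$.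 Let $\alpha_{\min}=2^{(\gamma-1)/(\gamma-d)}$, $0<\Omega<\Omega_{\max}=(4\alpha_{\min})^{1-d}$, $\alpha_{\max}=\frac14\Omega^{-1/(d-1)}$ and $\alpha_{\min}<\alpha<\alpha_{\max}$. Then there is a constant $T_1>0$, depending only on $\alpha,\Omega,\gamma$ and $d$, such that the following holds. Let $r>0$ and let $A,F\subset\mathbb{R}^d$ be such that $A$ is connected, $A$ is covered by $\mathring N$ open balls of radius $r$, the solid angle of $F$ from any $x\in A^{r/(\alpha-1)}$ is less than $\Omega$, and the set of lines $[F]$ is $\mu_d$-measurable (as it is for every Borel set $F$). Put $$T_{A,F}=\sup_{x,y\in A}\ \inf\{T(\xi):\ \xi \text{ a } \Pi_{[A^{r/(\alpha-1)}]\setminus[F]}\text{-path from } x \text{ to } y\}\in[0,\infty],\qquad T_{r,\mathring N}=\mathring N\,T_1\,r^{(\gamma-d)/(\gamma-1)}.$$ 1. For every $\varepsilon$ with $0<\varepsilon<\varepsilon_{\max}=\frac{1}{2\mathring N(2\alpha+1)^d}$, with probability at least $1-\varepsilon/\varepsilon_{\max}$, $$T_{A,F}\le T_{r,\mathring N}\left(\ln\frac1\varepsilon\right)^{1/(\gamma-1)}.$$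 2. For every $\delta<T_{r,\mathring N}^{-(\gamma-1)}$, $\ \mathbb{E}\left[\exp\left(\delta\,T_{A,F}^{\gamma-1}\right)\right]<\infty$. (Since $T_{A,F}$ is not asserted to be measurable, the probability of failure in 1 is an outer probability, and the expectation in 2 is an upper expectation, the infimum of the expectations of measurable majorants.) -/

import Mathlib

open MeasureTheory ProbabilityTheory Set
open scoped ENNReal NNReal RealInnerProductSpace

noncomputable section

/-- Euclidean space `ℝ^d`. -/
abbrev E (d : ℕ) : Type := EuclideanSpace ℝ (Fin d)

/-! ### Lines and the invariant line measure -/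

/-- The space of (unsensed) lines of `ℝ^d`: one-dimensional affine subspaces. -/
def Line (d : ℕ) : Type :=
  {l : AffineSubspace ℝ (E d) // Module.finrank ℝ l.direction = 1}

/-- The line through the point `x` with direction the unit vector `u`, for `p = (u, x)`. -/
def lineThrough {d : ℕ} (p : Metric.sphere (0 : E d) 1 × E d) : Line d :=
  ⟨AffineSubspace.mk' p.2 (Submodule.span ℝ {(p.1 : E d)}), by
    rw [AffineSubspace.direction_mk']
    exact finrank_span_singleton (ne_zero_of_mem_unit_sphere p.1)⟩

/-- The Borel `σ`-algebra of the space of lines: a set of lines is measurable if and only if the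
set of pairs (direction `u`, point `x`) describing its elements is a Borel set. -/
instance instMeasurableSpaceLine (d : ℕ) : MeasurableSpace (Line d) :=
  MeasurableSpace.map (lineThrough (d := d)) inferInstance

/-- The hitting set `[K]`: the set of lines that meet `K`. -/
def hitting {d : ℕ} (K : Set (E d)) : Set (Line d) :=
  {l | ((l.1 : Set (E d)) ∩ K).Nonempty}

/-- The isometry invariant line measure `μ_d`, normalized so that the lines hitting a convex body
`K` have measure half the area of the boundary of `K`.

It is `1 / (2 ν)` times the measure `du dp`, where `ν` is the volume of the unit ball of `ℝ^(d-1)`,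
`du` is the area measure of the unit sphere (every line has two unit directions `±u`, hence the
factor `2`) and `dp` is the Lebesgue measure on the hyperplane `u^⊥`, the line being `p + ℝ u`.
Here `dp` is written as the image under the orthogonal projection onto `u^⊥` of the Lebesgue
measure `dx` on the slab `0 ≤ ⟪u, x⟫ ≤ 1` of width one; the lines through `x` and through its
projection in the direction `u` are the same. -/
def lineMeasure (d : ℕ) : Measure (Line d) :=
  (2 * volume (Metric.ball (0 : E (d - 1)) 1))⁻¹ •
    ((((volume : Measure (E d)).toSphere).prod (volume : Measure (E d))).restrict
      {p | ⟪(p.1 : E d), p.2⟫ ∈ Icc (0 : ℝ) 1}).map lineThrough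

/-- The solid angle of `F` seen from `x`: the proportion of directions `u` such that the line
through `x` with direction `u` meets `F`.  This set of directions is symmetric under `u ↦ -u`,
so that the proportion is the same on the sphere and on the projective space. -/
def solidAngle {d : ℕ} (F : Set (E d)) (x : E d) : ℝ≥0∞ :=
  (volume : Measure (E d)).toSphere {u | lineThrough (u, x) ∈ hitting F} /
    (volume : Measure (E d)).toSphere univ

/-! ### The Poisson process of marked lines -/

/-- The measure `(γ - 1) v^(-γ) dv` on speeds `v > 0`. -/
def speedMeasure (γ : ℝ) : Measure ℝ :=
  (volume.restrict (Ioi (0 : ℝ))).withDensity fun v => ENNReal.ofReal ((γ - 1) * v ^ (-γ))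

/-- The intensity measure `dμ_{d,γ}(l, v) = dμ_d(l) (γ - 1) v^(-γ) dv` on marked lines. -/
def markedLineMeasure (d : ℕ) (γ : ℝ) : Measure (Line d × ℝ) :=
  (lineMeasure d).prod (speedMeasure γ)

/-- `N` is a Poisson point process on `X` with intensity measure `Λ`: a random set of points such
that the number of points in a measurable set `B` is a random variable with the Poisson law of
parameter `Λ B` (almost surely infinite when `Λ B = ∞`), and the numbers of points in disjoint
measurable sets are independent. -/
structure IsPoissonProcess {Ω X : Type*} [MeasurableSpace Ω] [MeasurableSpace X]
    (P : Measure Ω) (N : Ω → Set X) (Λ : Measure X) : Prop where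
  measurable_count : ∀ B : Set X, MeasurableSet B → Measurable fun ω => (N ω ∩ B).encard
  law_count : ∀ B : Set X, MeasurableSet B → Λ B ≠ ∞ →
    P.map (fun ω => (N ω ∩ B).encard) =
      (poissonMeasure (Λ B).toNNReal).map fun n : ℕ => (n : ℕ∞)
  count_eq_top : ∀ B : Set X, MeasurableSet B → Λ B = ∞ → ∀ᵐ ω ∂P, (N ω ∩ B).encard = ⊤
  indep_count : ∀ (n : ℕ) (B : Fin n → Set X), (∀ i, MeasurableSet (B i)) →
    Pairwise (fun i j => Disjoint (B i) (B j)) →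
    iIndepFun (fun i ω => (N ω ∩ B i).encard) P

/-- The restriction `Γ_𝓛` of a set `Γ` of marked lines to the lines in `𝓛`. -/
def restrictLines {d : ℕ} (Γ : Set (Line d × ℝ)) (𝓛 : Set (Line d)) : Set (Line d × ℝ) :=
  {p ∈ Γ | p.1 ∈ 𝓛}

/-! ### Paths respecting the speed limits, travel times and time diameters -/

/-- `ξ : [0, T] → ℝ^d` is a finite-time path for the set `Γ` of marked lines: it is locally
Lipschitz, and at almost every time it either has zero speed or follows a line of `Γ` with a
speed that does not exceed the mark of that line. (Values of `ξ` off `[0, T]` are irrelevant.) -/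
structure IsLinePath {d : ℕ} (Γ : Set (Line d × ℝ)) (T : ℝ) (ξ : ℝ → E d) : Prop where
  time_nonneg : 0 ≤ T
  locallyLipschitz : LocallyLipschitzOn (Icc 0 T) ξ
  speed_limit : ∀ᵐ t ∂(volume.restrict (Icc 0 T)), ∃ w : E d, HasDerivAt ξ w t ∧
    (w = 0 ∨ ∃ p ∈ Γ, p.1.1 = AffineSubspace.mk' (ξ t) (Submodule.span ℝ {w}) ∧ ‖w‖ ≤ p.2)

/-- The `Γ`-length between `x` and `y`: the infimum of the times of the `Γ`-paths from `x` to `y`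
(`∞` if there is none). -/
def travelTime {d : ℕ} (Γ : Set (Line d × ℝ)) (x y : E d) : ℝ≥0∞ :=
  ⨅ (T : ℝ) (_ : ∃ ξ : ℝ → E d, IsLinePath Γ T ξ ∧ ξ 0 = x ∧ ξ T = y), ENNReal.ofReal T

/-- The diameter of `A` for the `Γ`-length. -/
def timeDiam {d : ℕ} (Γ : Set (Line d × ℝ)) (A : Set (E d)) : ℝ≥0∞ :=
  ⨆ x ∈ A, ⨆ y ∈ A, travelTime Γ x y

/-- The (upper) expectation of a `[0, ∞]`-valued function: the infimum of the expectations of its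
measurable majorants. It is the expectation if the function is measurable, see
`upperExpectation_eq_lintegral`. -/
def upperExpectation {Ω : Type*} [MeasurableSpace Ω] (P : Measure Ω) (f : Ω → ℝ≥0∞) : ℝ≥0∞ :=
  ⨅ (g : Ω → ℝ≥0∞) (_ : Measurable g ∧ f ≤ g), ∫⁻ ω, g ω ∂P

theorem upperExpectation_eq_lintegral {Ω : Type*} [MeasurableSpace Ω] (P : Measure Ω)
    (f : Ω → ℝ≥0∞) (hf : Measurable f) : upperExpectation P f = ∫⁻ ω, f ω ∂P :=
  le_antisymm (iInf₂_le f ⟨hf, le_rfl⟩) (le_iInf₂ fun _ hg => lintegral_mono hg.2)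

end

noncomputable section

/-! ### Concatenation of paths -/

/-- At time `t` the path `ξ` stands still or follows a line of `Γ` below its speed limit. -/
def RespectsLimitAt {d : ℕ} (Γ : Set (Line d × ℝ)) (ξ : ℝ → E d) (t : ℝ) : Prop :=
  ∃ w : E d, HasDerivAt ξ w t ∧
    (w = 0 ∨ ∃ p ∈ Γ, p.1.1 = AffineSubspace.mk' (ξ t) (Submodule.span ℝ {w}) ∧ ‖w‖ ≤ p.2)

/-- The times of `[0, T]` at which `ξ` does not respect the speed limits. -/
def badTimes {d : ℕ} (Γ : Set (Line d × ℝ)) (T : ℝ) (ξ : ℝ → E d) : Set ℝ :=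
  {t | t ∈ Icc 0 T ∧ ¬ RespectsLimitAt Γ ξ t}

/-- The path `f` up to time `T`, followed by the path `g`. -/
def concatPath {X : Type*} (T : ℝ) (f g : ℝ → X) (t : ℝ) : X := if t ≤ T then f t else g (t - T)

theorem concatPath_of_le {X : Type*} {T t : ℝ} (f g : ℝ → X) (h : t ≤ T) :
    concatPath T f g t = f t := if_pos h

theorem concatPath_of_ge {X : Type*} {T t : ℝ} {f g : ℝ → X} (hfg : f T = g 0) (h : T ≤ t) :
    concatPath T f g t = g (t - T) := by
  rcases h.eq_or_lt with rfl | h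
  · rw [concatPath_of_le _ _ le_rfl, hfg, sub_self]
  · exact if_neg (not_le.2 h)

theorem lipschitzOnWith_concatPath {X : Type*} [PseudoMetricSpace X] {V : ℝ≥0} {T₁ T₂ : ℝ}
    {f g : ℝ → X} (h1 : 0 ≤ T₁)
    (hf : LipschitzOnWith V f (Icc 0 T₁)) (hg : LipschitzOnWith V g (Icc 0 T₂))
    (hfg : f T₁ = g 0) : LipschitzOnWith V (concatPath T₁ f g) (Icc 0 (T₁ + T₂)) := by
  have key : ∀ s ∈ Icc 0 (T₁ + T₂), ∀ t ∈ Icc 0 (T₁ + T₂), s ≤ t →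
      dist (concatPath T₁ f g s) (concatPath T₁ f g t) ≤ V * (t - s) := by
    intro s hs t ht hst
    rcases le_total t T₁ with h | h
    · rw [concatPath_of_le _ _ h, concatPath_of_le _ _ (hst.trans h)]
      have := hf.dist_le_mul s ⟨hs.1, hst.trans h⟩ t ⟨ht.1, h⟩
      rwa [dist_comm s t, Real.dist_eq, abs_of_nonneg (sub_nonneg.2 hst)] at this
    · have h2 : (0 : ℝ) ∈ Icc 0 T₂ := ⟨le_rfl, by linarith [ht.2]⟩
      rw [concatPath_of_ge hfg h]
      rcases le_total s T₁ with h' | h'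
      · rw [concatPath_of_le _ _ h']
        have a := hf.dist_le_mul s ⟨hs.1, h'⟩ T₁ ⟨h1, le_rfl⟩
        have b := hg.dist_le_mul 0 h2 (t - T₁) ⟨by linarith, by linarith [ht.2]⟩
        rw [dist_comm s, Real.dist_eq, abs_of_nonneg (sub_nonneg.2 h')] at a
        rw [dist_comm 0, Real.dist_eq, sub_zero, abs_of_nonneg (sub_nonneg.2 h), ← hfg] at b
        calc _ ≤ _ := dist_triangle _ (f T₁) _
          _ ≤ _ := add_le_add a b
          _ = _ := by ring
      · rw [concatPath_of_ge hfg h']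
        have b := hg.dist_le_mul (s - T₁) ⟨by linarith, by linarith [hs.2]⟩ (t - T₁)
          ⟨by linarith, by linarith [ht.2]⟩
        rwa [dist_comm (s - T₁), Real.dist_eq, sub_sub_sub_cancel_right,
          abs_of_nonneg (sub_nonneg.2 hst)] at b
  refine LipschitzOnWith.of_dist_le_mul fun s hs t ht => ?_
  rcases le_total s t with h | h
  · rw [dist_comm s t, Real.dist_eq, abs_of_nonneg (sub_nonneg.2 h)]
    exact key s hs t ht h
  · rw [Real.dist_eq, abs_of_nonneg (sub_nonneg.2 h), dist_comm]
    exact key t ht s hs h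

theorem RespectsLimitAt.congr {d : ℕ} {Γ : Set (Line d × ℝ)} {ξ η : ℝ → E d} {t : ℝ}
    (h : RespectsLimitAt Γ ξ t) (he : η =ᶠ[nhds t] ξ) : RespectsLimitAt Γ η t := by
  obtain ⟨w, hw, h⟩ := h
  exact ⟨w, hw.congr_of_eventuallyEq he, by rwa [he.eq_of_nhds]⟩

theorem RespectsLimitAt.comp_sub {d : ℕ} {Γ : Set (Line d × ℝ)} {ξ : ℝ → E d} {t a : ℝ}
    (h : RespectsLimitAt Γ ξ (t - a)) : RespectsLimitAt Γ (fun s => ξ (s - a)) t := by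
  obtain ⟨w, hw, h⟩ := h
  exact ⟨w, hw.comp_sub_const t a, h⟩

theorem volume_badTimes_concatPath_le {d : ℕ} (Γ : Set (Line d × ℝ)) (T₁ T₂ : ℝ) (f g : ℝ → E d) :
    volume (badTimes Γ (T₁ + T₂) (concatPath T₁ f g)) ≤
      volume (badTimes Γ T₁ f) + volume (badTimes Γ T₂ g) := by
  have hsub : badTimes Γ (T₁ + T₂) (concatPath T₁ f g) ⊆
      (badTimes Γ T₁ f ∪ (fun t => t + -T₁) ⁻¹' badTimes Γ T₂ g) ∪ {T₁} := by
    rintro t ⟨ht, hb⟩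
    rcases lt_trichotomy t T₁ with h | h | h
    · refine Or.inl (Or.inl ⟨⟨ht.1, h.le⟩, fun hg => hb (hg.congr ?_)⟩)
      filter_upwards [Iio_mem_nhds h] with s hs
      exact concatPath_of_le _ _ (le_of_lt hs)
    · exact Or.inr h
    · refine Or.inl (Or.inr ⟨⟨by linarith, by linarith [ht.2]⟩, fun hg => hb ?_⟩)
      refine RespectsLimitAt.congr (RespectsLimitAt.comp_sub (a := T₁) hg) ?_
      filter_upwards [Ioi_mem_nhds h] with s hs
      exact if_neg (not_le.2 hs)
  calc _ ≤ _ := measure_mono hsub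
    _ ≤ _ := measure_union_le _ _
    _ ≤ _ := add_le_add_left (measure_union_le _ _) _
    _ = _ := by rw [measure_preimage_add_right]; simp

/-! ### Segments -/

/-- The uniform motion from `p` to `q` in the time interval `[0, T]`. -/
def segmentPath {d : ℕ} (T : ℝ) (p q : E d) (t : ℝ) : E d :=
  AffineMap.lineMap p q (max 0 (min 1 (t / T)))

theorem segmentPath_zero {d : ℕ} (T : ℝ) (p q : E d) : segmentPath T p q 0 = p := by
  simp [segmentPath]

theorem segmentPath_end {d : ℕ} {T : ℝ} (hT : 0 < T) (p q : E d) : segmentPath T p q T = q := by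
  simp [segmentPath, div_self hT.ne']

theorem dist_segmentPath_left_le {d : ℕ} (T : ℝ) (p q : E d) (t : ℝ) :
    dist (segmentPath T p q t) p ≤ dist p q := by
  rw [segmentPath, dist_lineMap_left, Real.norm_eq_abs, abs_of_nonneg (le_max_left _ _)]
  exact mul_le_of_le_one_left dist_nonneg (max_le zero_le_one (min_le_left _ _))

theorem lipschitzWith_segmentPath {d : ℕ} {T : ℝ} (hT : 0 < T) {V : ℝ≥0} {p q : E d}
    (h : dist p q ≤ V * T) : LipschitzWith V (segmentPath T p q) := by
  refine LipschitzWith.of_dist_le_mul fun s t => ?_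
  rw [segmentPath, segmentPath, dist_lineMap_lineMap]
  have h1 : dist (max 0 (min 1 (s / T))) (max 0 (min 1 (t / T))) ≤ dist s t / T := by
    have := ((LipschitzWith.id.const_min (1 : ℝ)).const_max 0).dist_le_mul (s / T) (t / T)
    simp only [id, NNReal.coe_one, one_mul] at this
    refine this.trans_eq ?_
    rw [Real.dist_eq, Real.dist_eq, ← sub_div, abs_div, abs_of_pos hT]
  calc _ ≤ dist s t / T * (V * T) := by gcongr
    _ = _ := by field_simp

theorem respectsLimitAt_segmentPath {d : ℕ} {Γ : Set (Line d × ℝ)} {T : ℝ} {p q : E d}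
    {m : Line d × ℝ} (hm : m ∈ Γ) (hp : p ∈ m.1.1) (hq : q ∈ m.1.1) (h : dist p q ≤ m.2 * T)
    {t : ℝ} (ht : t ∈ Ioo 0 T) : RespectsLimitAt Γ (segmentPath T p q) t := by
  have hT : 0 < T := ht.1.trans ht.2
  have hlin : RespectsLimitAt Γ (fun s => AffineMap.lineMap p q (s / T)) t := by
    refine ⟨T⁻¹ • (q - p), ?_, ?_⟩
    · have h1 : HasDerivAt (fun s : ℝ => s / T) (1 / T) t := (hasDerivAt_id t).div_const T
      have h2 := (AffineMap.hasDerivAt_lineMap (a := p) (b := q) (x := t / T)).scomp t h1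
      rwa [one_div] at h2
    · by_cases hpq : q - p = 0
      · exact Or.inl (by rw [hpq, smul_zero])
      refine Or.inr ⟨m, hm, ?_, ?_⟩
      · have hmem : AffineMap.lineMap p q (t / T) ∈ m.1.1 := AffineMap.lineMap_mem _ hp hq
        rw [← AffineSubspace.mk'_eq hmem]
        congr 1
        have hdir : q - p ∈ m.1.1.direction := AffineSubspace.vsub_mem_direction hq hp
        rw [Submodule.span_singleton_smul_eq (IsUnit.mk0 _ (inv_ne_zero hT.ne'))]
        symm
        apply Submodule.eq_of_le_of_finrank_eq
        · rwa [Submodule.span_singleton_le_iff_mem]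
        · rw [finrank_span_singleton hpq, m.1.2]
      · rw [norm_smul, norm_inv, Real.norm_eq_abs, abs_of_pos hT, ← dist_eq_norm, dist_comm,
          inv_mul_le_iff₀ hT, mul_comm]
        exact h
  refine hlin.congr ?_
  filter_upwards [Ioo_mem_nhds ht.1 ht.2] with s hs
  have h1 : s / T ≤ 1 := (div_le_one hT).2 hs.2.le
  have h0 : 0 ≤ s / T := div_nonneg hs.1.le hT.le
  rw [segmentPath, min_eq_right h1, max_eq_right h0]

theorem volume_badTimes_segmentPath {d : ℕ} {Γ : Set (Line d × ℝ)} {T : ℝ} {p q : E d}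
    {m : Line d × ℝ} (hm : m ∈ Γ) (hp : p ∈ m.1.1) (hq : q ∈ m.1.1) (h : dist p q ≤ m.2 * T) :
    volume (badTimes Γ T (segmentPath T p q)) = 0 := by
  refine measure_mono_null (t := {0, T}) ?_ ((Set.toFinite _).measure_zero _)
  rintro t ⟨ht, hb⟩
  by_contra hne
  simp only [mem_insert_iff, mem_singleton_iff, not_or] at hne
  exact hb (respectsLimitAt_segmentPath hm hp hq h
    ⟨lt_of_le_of_ne ht.1 (Ne.symm hne.1), lt_of_le_of_ne ht.2 hne.2⟩)

/-! ### Paths built from a hierarchy of lines -/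

/-- A path with Lipschitz constant `V` from `x` to `y` in time `T` respecting the speed limits. -/
structure Connects {d : ℕ} (Γ : Set (Line d × ℝ)) (V : ℝ≥0) (T : ℝ) (ξ : ℝ → E d) (x y : E d) :
    Prop where
  time_nonneg : 0 ≤ T
  source : ξ 0 = x
  target : ξ T = y
  lipschitz : LipschitzOnWith V ξ (Icc 0 T)
  volume_badTimes : volume (badTimes Γ T ξ) = 0

theorem Connects.concat {d : ℕ} {Γ : Set (Line d × ℝ)} {V : ℝ≥0} {T₁ T₂ : ℝ} {f g : ℝ → E d}
    {x y z : E d} (hf : Connects Γ V T₁ f x y) (hg : Connects Γ V T₂ g y z) :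
    Connects Γ V (T₁ + T₂) (concatPath T₁ f g) x z := by
  have hfg : f T₁ = g 0 := by rw [hf.target, hg.source]
  refine ⟨add_nonneg hf.time_nonneg hg.time_nonneg, ?_, ?_, ?_, ?_⟩
  · rw [concatPath_of_le _ _ hf.time_nonneg, hf.source]
  · rw [concatPath_of_ge hfg (le_add_of_nonneg_right hg.time_nonneg), add_sub_cancel_left,
      hg.target]
  · exact lipschitzOnWith_concatPath hf.time_nonneg hf.lipschitz hg.lipschitz hfg
  · refine le_antisymm ((volume_badTimes_concatPath_le _ _ _ _ _).trans ?_) zero_le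
    rw [hf.volume_badTimes, hg.volume_badTimes, add_zero]

theorem Connects.travelTime_le {d : ℕ} {Γ : Set (Line d × ℝ)} {V : ℝ≥0} {T : ℝ} {ξ : ℝ → E d}
    {x y : E d} (h : Connects Γ V T ξ x y) : travelTime Γ x y ≤ ENNReal.ofReal T := by
  refine iInf₂_le T ⟨ξ, ⟨h.time_nonneg, ?_, ?_⟩, h.source, h.target⟩
  · intro x hx
    exact ⟨V, Icc 0 T, self_mem_nhdsWithin, h.lipschitz⟩
  · rw [ae_restrict_iff' measurableSet_Icc, ae_iff]
    refine measure_mono_null ?_ h.volume_badTimes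
    intro t ht
    rw [mem_ofPred_eq, Classical.not_imp] at ht
    exact ht

/-- The approximations of the path which, at level `k`, goes from `x` to `y` by following the
segment from `P k x y` to `Q k x y` during the time `t k`, the two remaining gaps being filled at
level `k + 1`. -/
def approxPath {d : ℕ} (P Q : ℕ → E d → E d → E d) (τ t : ℕ → ℝ) :
    ℕ → ℕ → E d → E d → ℝ → E d
  | 0, k, x, y => segmentPath (τ k) x y
  | n + 1, k, x, y => concatPath (τ (k + 1)) (approxPath P Q τ t n (k + 1) x (P k x y))
      (concatPath (t k) (segmentPath (t k) (P k x y) (Q k x y))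
        (approxPath P Q τ t n (k + 1) (Q k x y) y))

/-- The limit of the paths `approxPath`. -/
def limitPath {d : ℕ} (P Q : ℕ → E d → E d → E d) (τ t : ℕ → ℝ) (k : ℕ) (x y : E d) (s : ℝ) :
    E d :=
  Filter.limUnder Filter.atTop fun n => approxPath P Q τ t n k x y s

theorem connects_limitPath {d : ℕ} {Γ : Set (Line d × ℝ)} {V : ℝ≥0} {P Q : ℕ → E d → E d → E d}
    {τ t D : ℕ → ℝ} {R : ℕ → E d → E d → Prop}
    (hRP : ∀ k x y, R k x y → R (k + 1) x (P k x y))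
    (hRQ : ∀ k x y, R k x y → R (k + 1) (Q k x y) y)
    (ht : ∀ k, 0 < t k) (hτ0 : ∀ k, 0 < τ k)
    (hτ : ∀ k, τ k = τ (k + 1) + (t k + τ (k + 1)))
    (hlim : Filter.Tendsto (fun n => 2 ^ n * τ n) Filter.atTop (nhds 0))
    (hD : Summable D) (hDanti : Antitone D)
    (hRD : ∀ k x y, R k x y → dist x y ≤ D k)
    (hV1 : ∀ k x y, R k x y → dist x y ≤ V * τ k)
    (hV2 : ∀ k x y, R k x y → dist (P k x y) (Q k x y) ≤ V * t k)
    (hΓ : ∀ k x y, R k x y → ∃ m ∈ Γ, P k x y ∈ m.1.1 ∧ Q k x y ∈ m.1.1 ∧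
      dist (P k x y) (Q k x y) ≤ m.2 * t k)
    (k : ℕ) (x y : E d) (hR : R k x y) :
    Connects Γ V (τ k) (limitPath P Q τ t k x y) x y := by
  set f := approxPath P Q τ t with hf
  have hfs : ∀ n k x y, f (n + 1) k x y = concatPath (τ (k + 1)) (f n (k + 1) x (P k x y))
      (concatPath (t k) (segmentPath (t k) (P k x y) (Q k x y)) (f n (k + 1) (Q k x y) y)) :=
    fun _ _ _ _ => rfl
  have hend : ∀ n k x y, f n k x y 0 = x ∧ f n k x y (τ k) = y := by
    intro n
    induction n with
    | zero => exact fun k x y => ⟨segmentPath_zero _ _ _, segmentPath_end (hτ0 k) _ _⟩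
    | succ n ih =>
      intro k x y
      rw [hfs]
      have e1 : segmentPath (t k) (P k x y) (Q k x y) (t k) = f n (k + 1) (Q k x y) y 0 := by
        rw [(ih _ _ _).1, segmentPath_end (ht k)]
      constructor
      · rw [concatPath_of_le _ _ (hτ0 _).le, (ih _ _ _).1]
      · rw [concatPath_of_ge _ (by linarith [hτ k, ht k, hτ0 (k + 1)]),
          concatPath_of_ge e1 (by linarith [hτ k, ht k, hτ0 (k + 1)]),
          show τ k - τ (k + 1) - t k = τ (k + 1) by linarith [hτ k], (ih _ _ _).2]
        rw [concatPath_of_le _ _ (ht k).le, (ih _ _ _).2, segmentPath_zero]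
  have hlip : ∀ n k x y, R k x y → LipschitzOnWith V (f n k x y) (Icc 0 (τ k)) := by
    intro n
    induction n with
    | zero =>
      exact fun k x y h => (lipschitzWith_segmentPath (hτ0 k) (hV1 k x y h)).lipschitzOnWith
    | succ n ih =>
      intro k x y h
      rw [hfs, hτ k]
      refine lipschitzOnWith_concatPath (hτ0 _).le (ih _ _ _ (hRP _ _ _ h)) ?_ ?_
      · refine lipschitzOnWith_concatPath (ht k).le
          (lipschitzWith_segmentPath (ht k) (hV2 k x y h)).lipschitzOnWith
          (ih _ _ _ (hRQ _ _ _ h)) ?_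
        rw [(hend _ _ _ _).1, segmentPath_end (ht k)]
      · rw [concatPath_of_le _ _ (ht k).le, (hend _ _ _ _).2, segmentPath_zero]
  have hcauchy : ∀ n k x y, R k x y → ∀ s, dist (f n k x y s) (f (n + 1) k x y s) ≤
      6 * D (k + n) := by
    intro n
    induction n with
    | zero =>
      intro k x y h s
      have a := hRD _ _ _ h
      have b := hRD _ _ _ (hRP _ _ _ h)
      have c := hRD _ _ _ (hRQ _ _ _ h)
      have hD' : D (k + 1) ≤ D k := hDanti (Nat.le_succ k)
      have e := dist_segmentPath_left_le (τ k) x y s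
      rw [hfs, add_zero]
      change dist (segmentPath (τ k) x y s) _ ≤ _
      refine (dist_triangle _ x _).trans ?_
      have h0 : 0 ≤ D k := dist_nonneg.trans a
      suffices h2 : dist x (concatPath (τ (k + 1)) (f 0 (k + 1) x (P k x y))
          (concatPath (t k) (segmentPath (t k) (P k x y) (Q k x y)) (f 0 (k + 1) (Q k x y) y)) s) ≤
          5 * D k by linarith
      unfold concatPath
      split_ifs
      · rw [dist_comm]
        have := dist_segmentPath_left_le (τ (k + 1)) x (P k x y) s
        change dist (segmentPath (τ (k + 1)) x (P k x y) s) x ≤ _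
        linarith
      · have h1 := dist_segmentPath_left_le (t k) (P k x y) (Q k x y) (s - τ (k + 1))
        have h3 := dist_triangle4 (P k x y) x y (Q k x y)
        have h4 := dist_triangle x (P k x y)
          (segmentPath (t k) (P k x y) (Q k x y) (s - τ (k + 1)))
        rw [dist_comm (P k x y) x, dist_comm y] at h3
        rw [dist_comm (P k x y) (segmentPath _ _ _ _)] at h4
        linarith
      · have h1 := dist_segmentPath_left_le (τ (k + 1)) (Q k x y) y (s - τ (k + 1) - t k)
        have h4 := dist_triangle4 x y (Q k x y)
          (segmentPath (τ (k + 1)) (Q k x y) y (s - τ (k + 1) - t k))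
        rw [dist_comm y, dist_comm (Q k x y) (segmentPath _ _ _ _)] at h4
        change dist x (segmentPath (τ (k + 1)) (Q k x y) y (s - τ (k + 1) - t k)) ≤ _
        linarith
    | succ n ih =>
      intro k x y h s
      have h0 : 0 ≤ D (k + (n + 1)) := by
        have := dist_nonneg.trans (ih _ _ _ (hRP _ _ _ h) 0)
        rw [show k + (n + 1) = k + 1 + n by omega]
        linarith
      have hP := ih _ _ _ (hRP _ _ _ h)
      have hQ := ih _ _ _ (hRQ _ _ _ h)
      rw [show k + (n + 1) = k + 1 + n by omega] at *
      rw [hfs, hfs (n + 1)]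
      unfold concatPath
      split_ifs
      · exact hP _
      · rw [dist_self]; linarith
      · exact hQ _
  have htend : ∀ k x y, R k x y → ∀ s,
      Filter.Tendsto (fun n => f n k x y s) Filter.atTop (nhds (limitPath P Q τ t k x y s)) := by
    intro k x y h s
    refine (cauchySeq_of_dist_le_of_summable (fun n => 6 * D (k + n))
      (fun n => hcauchy n k x y h s) ?_).tendsto_limUnder
    simp_rw [add_comm k]
    exact ((summable_nat_add_iff k).2 hD).mul_left 6
  have hself : ∀ k x y, R k x y → limitPath P Q τ t k x y =
      concatPath (τ (k + 1)) (limitPath P Q τ t (k + 1) x (P k x y))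
      (concatPath (t k) (segmentPath (t k) (P k x y) (Q k x y))
        (limitPath P Q τ t (k + 1) (Q k x y) y)) := by
    intro k x y h
    funext s
    refine tendsto_nhds_unique ((Filter.tendsto_add_atTop_iff_nat 1).2 (htend k x y h s)) ?_
    simp_rw [hfs]
    unfold concatPath
    split_ifs
    · exact htend _ _ _ (hRP _ _ _ h) _
    · exact tendsto_const_nhds
    · exact htend _ _ _ (hRQ _ _ _ h) _
  have hbad : ∀ n k x y, R k x y → volume (badTimes Γ (τ k) (limitPath P Q τ t k x y)) ≤
      ENNReal.ofReal (2 ^ n * τ (k + n)) := by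
    intro n
    induction n with
    | zero =>
      intro k x y h
      refine (measure_mono (t := Icc 0 (τ k)) fun s hs => hs.1).trans_eq ?_
      rw [Real.volume_Icc]; simp
    | succ n ih =>
      intro k x y h
      obtain ⟨m, hm, hp, hq, hle⟩ := hΓ k x y h
      rw [hself k x y h, hτ k]
      refine (volume_badTimes_concatPath_le _ _ _ _ _).trans ?_
      refine (add_le_add_right (volume_badTimes_concatPath_le _ _ _ _ _) _).trans ?_
      rw [volume_badTimes_segmentPath hm hp hq hle, zero_add]
      refine (add_le_add (ih _ _ _ (hRP _ _ _ h)) (ih _ _ _ (hRQ _ _ _ h))).trans_eq ?_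
      rw [← ENNReal.ofReal_add (mul_nonneg (by positivity) (hτ0 _).le)
        (mul_nonneg (by positivity) (hτ0 _).le), show k + (n + 1) = k + 1 + n by omega]
      congr 1; ring
  refine ⟨(hτ0 k).le, ?_, ?_, ?_, ?_⟩
  · exact tendsto_nhds_unique (htend k x y hR 0) (by simp_rw [(hend _ k x y).1]; simp)
  · exact tendsto_nhds_unique (htend k x y hR (τ k)) (by simp_rw [(hend _ k x y).2]; simp)
  · refine LipschitzOnWith.of_dist_le_mul fun s hs s' hs' => ?_
    exact le_of_tendsto ((htend k x y hR s).dist (htend k x y hR s'))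
      (Filter.Eventually.of_forall fun n => (hlip n k x y hR).dist_le_mul s hs s' hs')
  · refine le_antisymm (ge_of_tendsto' (x := Filter.atTop) ?_
      (fun n => hbad n k x y hR)) zero_le
    have h1 : Filter.Tendsto (fun n => (2 ^ k : ℝ)⁻¹ * (2 ^ (n + k) * τ (n + k)))
        Filter.atTop (nhds ((2 ^ k)⁻¹ * 0)) :=
      ((Filter.tendsto_add_atTop_iff_nat k).2 hlim).const_mul _
    rw [mul_zero] at h1
    have h2 := ENNReal.tendsto_ofReal h1
    rw [ENNReal.ofReal_zero] at h2
    refine h2.congr fun n => ?_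
    congr 1
    rw [pow_add, add_comm n k]
    field_simp

/-! ### Chains of open sets -/

theorem exists_walk_of_isPreconnected {X : Type*} [TopologicalSpace X] {A : Set X}
    (hA : IsPreconnected A) {n : ℕ} {U : Fin n → Set X} (hU : ∀ i, IsOpen (U i))
    (hcov : A ⊆ ⋃ i, U i) {G : SimpleGraph (Fin n)}
    (hG : ∀ i j, i ≠ j → (A ∩ (U i ∩ U j)).Nonempty → G.Adj i j)
    {i j : Fin n} (hi : (A ∩ U i).Nonempty) (hj : (A ∩ U j).Nonempty) : G.Reachable i j := by
  by_contra hij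
  have h1 : IsOpen (⋃ k ∈ {k | G.Reachable i k}, U k) := isOpen_biUnion fun k _ => hU k
  have h2 : IsOpen (⋃ k ∈ {k | ¬ G.Reachable i k}, U k) := isOpen_biUnion fun k _ => hU k
  obtain ⟨z, hz, hz1, hz2⟩ := hA _ _ h1 h2 (fun z hz => by
      obtain ⟨k, hk⟩ := mem_iUnion.1 (hcov hz)
      by_cases hr : G.Reachable i k
      · exact Or.inl (mem_biUnion (show k ∈ {k | G.Reachable i k} from hr) hk)
      · exact Or.inr (mem_biUnion (show k ∈ {k | ¬ G.Reachable i k} from hr) hk))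
    (by
      obtain ⟨z, hz, hzi⟩ := hi
      exact ⟨z, hz, mem_biUnion (show i ∈ {k | G.Reachable i k} from .refl i) hzi⟩)
    (by
      obtain ⟨z, hz, hzj⟩ := hj
      exact ⟨z, hz, mem_biUnion (show j ∈ {k | ¬ G.Reachable i k} from hij) hzj⟩)
  obtain ⟨a, ha, hza⟩ := mem_iUnion₂.1 hz1
  obtain ⟨b, hb, hzb⟩ := mem_iUnion₂.1 hz2
  have hab : a ≠ b := by
    rintro rfl
    exact hb ha
  exact hb (SimpleGraph.Reachable.trans ha (hG a b hab ⟨z, hz, hza, hzb⟩).reachable)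

theorem timeDiam_le_of_cover {d : ℕ} {Γ : Set (Line d × ℝ)} {V : ℝ≥0} {T : ℝ} (hT : 0 ≤ T)
    {A : Set (E d)} (hA : IsPreconnected A) {n : ℕ} {U : Fin n → Set (E d)}
    (hU : ∀ i, IsOpen (U i)) (hcov : A ⊆ ⋃ i, U i)
    (h : ∀ i, ∀ x ∈ A ∩ U i, ∀ y ∈ A ∩ U i, ∃ ξ, Connects Γ V T ξ x y) :
    timeDiam Γ A ≤ ENNReal.ofReal (n * T) := by
  let G : SimpleGraph (Fin n) :=
    { Adj := fun i j => i ≠ j ∧ (A ∩ (U i ∩ U j)).Nonempty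
      symm := ⟨fun i j h => ⟨h.1.symm, by rw [inter_comm (U j)]; exact h.2⟩⟩
      loopless := ⟨fun i h => h.1 rfl⟩ }
  have hwalk : ∀ i j (w : G.Walk i j), ∀ x ∈ A ∩ U i, ∀ y ∈ A ∩ U j,
      ∃ ξ, Connects Γ V ((w.length + 1) * T) ξ x y := by
    intro i j w
    induction w with
    | nil =>
      intro x hx y hy
      simpa using h _ x hx y hy
    | cons hadj p ih =>
      intro x hx y hy
      obtain ⟨z, hzA, hz1, hz2⟩ := hadj.2
      obtain ⟨f, hf⟩ := h _ x hx z ⟨hzA, hz1⟩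
      obtain ⟨g, hg⟩ := ih z ⟨hzA, hz2⟩ y hy
      refine ⟨concatPath T f g, ?_⟩
      convert hf.concat hg using 1
      rw [SimpleGraph.Walk.length_cons]
      push_cast
      ring
  refine iSup₂_le fun x hx => iSup₂_le fun y hy => ?_
  obtain ⟨i, hi⟩ := mem_iUnion.1 (hcov hx)
  obtain ⟨j, hj⟩ := mem_iUnion.1 (hcov hy)
  obtain ⟨w⟩ := exists_walk_of_isPreconnected (G := G) hA hU hcov (fun a b hab hne => ⟨hab, hne⟩)
    ⟨x, hx, hi⟩ ⟨y, hy, hj⟩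
  obtain ⟨ξ, hξ⟩ := hwalk i j w.toPath.1 x ⟨hx, hi⟩ y ⟨hy, hj⟩
  refine hξ.travelTime_le.trans (ENNReal.ofReal_le_ofReal (mul_le_mul_of_nonneg_right ?_ hT))
  have := w.toPath.2.length_lt
  rw [Fintype.card_fin] at this
  exact_mod_cast this

/-! ### Measurability of hitting sets -/

theorem lineThrough_mem_hitting_iff {d : ℕ} {K : Set (E d)} {p : Metric.sphere (0 : E d) 1 × E d} :
    lineThrough p ∈ hitting K ↔ ∃ t : ℝ, p.2 + t • (p.1 : E d) ∈ K := by
  constructor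
  · rintro ⟨y, hy, hK⟩
    have hy' : y -ᵥ p.2 ∈ Submodule.span ℝ {(p.1 : E d)} := AffineSubspace.mem_mk'.1 hy
    obtain ⟨t, ht⟩ := Submodule.mem_span_singleton.1 hy'
    exact ⟨t, by rwa [ht, vsub_eq_sub, add_sub_cancel]⟩
  · rintro ⟨t, ht⟩
    refine ⟨_, ?_, ht⟩
    refine AffineSubspace.mem_mk'.2 (Submodule.mem_span_singleton.2 ⟨t, ?_⟩)
    rw [vsub_eq_sub, add_sub_cancel_left]

theorem lineThrough_add_smul {d : ℕ} (u : Metric.sphere (0 : E d) 1) (x : E d) (t : ℝ) :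
    lineThrough (u, x + t • (u : E d)) = lineThrough (u, x) := by
  apply Subtype.ext
  change AffineSubspace.mk' (x + t • (u : E d)) _ = AffineSubspace.mk' x _
  ext y
  rw [AffineSubspace.mem_mk', AffineSubspace.mem_mk']
  have : y -ᵥ x = (y -ᵥ (x + t • (u : E d))) + t • (u : E d) := by
    simp only [vsub_eq_sub]; abel
  rw [this]
  exact (Submodule.add_mem_iff_left _
    (Submodule.smul_mem _ _ (Submodule.mem_span_singleton_self _))).symm

theorem measurable_lineThrough {d : ℕ} : Measurable (lineThrough (d := d)) := fun _ h => h

theorem measurableSet_hitting {d : ℕ} {U : Set (E d)} (hU : IsOpen U) :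
    MeasurableSet (hitting U) := by
  change MeasurableSet (lineThrough ⁻¹' hitting U)
  have : lineThrough ⁻¹' hitting U =
      ⋃ t : ℝ, (fun p : Metric.sphere (0 : E d) 1 × E d => p.2 + t • (p.1 : E d)) ⁻¹' U := by
    ext p
    simp only [mem_preimage, lineThrough_mem_hitting_iff, mem_iUnion]
  rw [this]
  refine (isOpen_iUnion fun t => hU.preimage ?_).measurableSet
  fun_prop

/-! ### From points and directions to lines -/

/-- A set invariant under translations along `u` occupies, in a ball of radius `s`, at most `2 s`
times its volume in a slab of unit width orthogonal to `u`. -/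
theorem volume_ball_inter_le {d : ℕ} {u : E d} (hu : ‖u‖ = 1) {H : Set (E d)}
    (hH : MeasurableSet H) (hinv : ∀ x (t : ℝ), x + t • u ∈ H ↔ x ∈ H) (b : E d) (s : ℝ) :
    volume (Metric.ball b s ∩ H) ≤
      ENNReal.ofReal (2 * s) * volume ({x | ⟪u, x⟫ ∈ Icc (0 : ℝ) 1} ∩ H) := by
  set B : Set (E d) := Metric.ball b s
  set S : Set (E d) := {x | ⟪u, x⟫ ∈ Icc (0 : ℝ) 1} with hS
  have hB : MeasurableSet B := measurableSet_ball
  have hSm : MeasurableSet S :=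
    (isClosed_Icc.preimage (continuous_const.inner continuous_id)).measurableSet
  have huu : ⟪u, u⟫ = (1 : ℝ) := by rw [real_inner_self_eq_norm_sq, hu, one_pow]
  have h1 : ∀ x, ∫⁻ t : ℝ, S.indicator 1 (x + (-t) • u) = 1 := by
    intro x
    have : ∀ t : ℝ, S.indicator (1 : E d → ℝ≥0∞) (x + (-t) • u) =
        (Icc (⟪u, x⟫ - 1) ⟪u, x⟫).indicator 1 t := by
      intro t
      apply indicator_eq_indicator
      · simp only [hS, mem_ofPred_eq, inner_add_right, inner_smul_right, huu, mem_Icc]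
        constructor <;> rintro ⟨h, h'⟩ <;> constructor <;> linarith
      · rfl
    simp_rw [this]
    rw [lintegral_indicator_one measurableSet_Icc, Real.volume_Icc]
    simp
  have h2 : ∀ x, ∫⁻ t : ℝ, B.indicator 1 (x + t • u) ≤ ENNReal.ofReal (2 * s) := by
    intro x
    have : ∀ t : ℝ, B.indicator (1 : E d → ℝ≥0∞) (x + t • u) ≤
        (Icc (⟪u, b - x⟫ - s) (⟪u, b - x⟫ + s)).indicator 1 t := by
      intro t
      by_cases ht : x + t • u ∈ B
      · have h3 := (abs_real_inner_le_norm u (x + t • u - b)).trans_lt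
          (by rw [hu, one_mul]; exact mem_ball_iff_norm.1 ht)
        rw [inner_sub_right, inner_add_right, inner_smul_right, huu, abs_lt] at h3
        have hmem : t ∈ Icc (⟪u, b - x⟫ - s) (⟪u, b - x⟫ + s) := by
          rw [inner_sub_right]
          constructor <;> linarith [h3.1, h3.2]
        rw [indicator_of_mem ht, indicator_of_mem hmem]
        rfl
      · rw [indicator_of_notMem ht]
        exact zero_le
    refine (lintegral_mono this).trans_eq ?_
    rw [lintegral_indicator_one measurableSet_Icc, Real.volume_Icc]
    congr 1; ring
  have hBi : Measurable (B.indicator (1 : E d → ℝ≥0∞)) := measurable_one.indicator hB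
  have hSi : Measurable (S.indicator (1 : E d → ℝ≥0∞)) := measurable_one.indicator hSm
  have hHi : Measurable (H.indicator (1 : E d → ℝ≥0∞)) := measurable_one.indicator hH
  have hmul : ∀ K : Set (E d), MeasurableSet K → volume (K ∩ H) =
      ∫⁻ x, K.indicator 1 x * H.indicator 1 x := by
    intro K hK
    rw [← lintegral_indicator_one (hK.inter hH)]
    congr 1
    funext x
    rw [inter_indicator_one, Pi.mul_apply]
  have hHt : ∀ x (t : ℝ), H.indicator (1 : E d → ℝ≥0∞) (x + t • u) = H.indicator 1 x :=
    fun x t => indicator_eq_indicator (hinv x t) rfl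
  calc volume (B ∩ H) = ∫⁻ x, B.indicator 1 x * H.indicator 1 x := hmul B hB
    _ = ∫⁻ x, ∫⁻ t : ℝ, B.indicator 1 x * H.indicator 1 x * S.indicator 1 (x + (-t) • u) := by
        congr 1; funext x
        rw [lintegral_const_mul _ (by fun_prop), h1, mul_one]
    _ = ∫⁻ t : ℝ, ∫⁻ x, B.indicator 1 x * H.indicator 1 x * S.indicator 1 (x + (-t) • u) :=
        lintegral_lintegral_swap (by
          refine Measurable.aemeasurable ?_
          simp only [Function.uncurry_def]
          fun_prop)
    _ = ∫⁻ t : ℝ, ∫⁻ x, B.indicator 1 (x + t • u) * H.indicator 1 x * S.indicator 1 x := by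
        congr 1; funext t
        rw [← lintegral_add_right_eq_self _ (t • u)]
        simp_rw [hHt, add_assoc, ← add_smul, add_neg_cancel, zero_smul, add_zero]
    _ = ∫⁻ x, ∫⁻ t : ℝ, B.indicator 1 (x + t • u) * H.indicator 1 x * S.indicator 1 x :=
        lintegral_lintegral_swap (by
          refine Measurable.aemeasurable ?_
          simp only [Function.uncurry_def]
          fun_prop)
    _ ≤ ∫⁻ x, ENNReal.ofReal (2 * s) * (S.indicator 1 x * H.indicator 1 x) := by
        refine lintegral_mono fun x => ?_
        simp_rw [mul_assoc]
        rw [lintegral_mul_const _ (by fun_prop), mul_comm (H.indicator 1 x)]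
        gcongr
        exact h2 x
    _ = _ := by rw [lintegral_const_mul _ (by fun_prop), hmul S hSm]

theorem lintegral_toSphere_le_lineMeasure {d : ℕ} {G : Set (Line d)} (hG : MeasurableSet G) (b : E d)
    (s : ℝ) :
    ∫⁻ x in Metric.ball b s, (volume : Measure (E d)).toSphere {u | lineThrough (u, x) ∈ G} ≤
      ENNReal.ofReal (2 * s) * (2 * volume (Metric.ball (0 : E (d - 1)) 1)) * lineMeasure d G := by
  set σ := (volume : Measure (E d)).toSphere
  have hG' : MeasurableSet (lineThrough ⁻¹' G) := hG
  have hslab : MeasurableSet {p : Metric.sphere (0 : E d) 1 × E d |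
      ⟪(p.1 : E d), p.2⟫ ∈ Icc (0 : ℝ) 1} :=
    (isClosed_Icc.preimage
      ((continuous_subtype_val.comp continuous_fst).inner continuous_snd)).measurableSet
  have hball : MeasurableSet {p : Metric.sphere (0 : E d) 1 × E d | p.2 ∈ Metric.ball b s} :=
    measurable_snd measurableSet_ball
  have hκ0 : 2 * volume (Metric.ball (0 : E (d - 1)) 1) ≠ 0 :=
    mul_ne_zero two_ne_zero (Metric.measure_ball_pos _ _ one_pos).ne'
  have hκ : 2 * volume (Metric.ball (0 : E (d - 1)) 1) ≠ ∞ :=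
    ENNReal.mul_ne_top ENNReal.ofNat_ne_top measure_ball_lt_top.ne
  have e1 : 2 * volume (Metric.ball (0 : E (d - 1)) 1) * lineMeasure d G =
      (σ.prod volume) (lineThrough ⁻¹' G ∩ {p | ⟪(p.1 : E d), p.2⟫ ∈ Icc (0 : ℝ) 1}) := by
    rw [lineMeasure, Measure.smul_apply, smul_eq_mul, ← mul_assoc,
      ENNReal.mul_inv_cancel hκ0 hκ, one_mul, Measure.map_apply measurable_lineThrough hG,
      Measure.restrict_apply hG']
  have e2 : ∫⁻ x in Metric.ball b s, σ {u | lineThrough (u, x) ∈ G} =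
      (σ.prod volume) (lineThrough ⁻¹' G ∩ {p | p.2 ∈ Metric.ball b s}) := by
    rw [Measure.prod_apply_symm (hG'.inter hball), ← lintegral_indicator measurableSet_ball]
    congr 1; funext x
    by_cases hx : x ∈ Metric.ball b s
    · rw [indicator_of_mem hx]
      congr 1
      ext u; simp only [mem_ofPred_eq, mem_preimage, mem_inter_iff, hx, and_true]
    · rw [indicator_of_notMem hx]
      symm
      convert measure_empty (μ := σ)
      ext u; simp only [mem_ofPred_eq, mem_preimage, mem_inter_iff, hx, and_false,
        mem_empty_iff_false]
  rw [mul_assoc, e1, e2, Measure.prod_apply (hG'.inter hball), Measure.prod_apply (hG'.inter hslab),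
    ← lintegral_const_mul _ (measurable_measure_prodMk_left (hG'.inter hslab))]
  refine lintegral_mono fun u => ?_
  have := volume_ball_inter_le (u := (u : E d)) (norm_eq_of_mem_sphere u)
    (H := {x | lineThrough (u, x) ∈ G}) (measurable_prodMk_left hG')
    (fun x t => by simp only [mem_ofPred_eq, lineThrough_add_smul]) b s
  rw [inter_comm, inter_comm _ {x | lineThrough (u, x) ∈ G}] at this
  exact this

/-! ### The solid angle of a ball -/

/-- The double cone of axis `e` and half-angle `arccos h`, cut at height `h`. -/
def cutCone {d : ℕ} (e : E d) (h : ℝ) : Set (E d) :=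
  {y | h * ‖y‖ < |⟪e, y⟫| ∧ |⟪e, y⟫| < h}

theorem measurableSet_cutCone {d : ℕ} (e : E d) (h : ℝ) : MeasurableSet (cutCone e h) := by
  have h1 : Continuous fun y : E d => h * ‖y‖ := by fun_prop
  have h2 : Continuous fun y : E d => |⟪e, y⟫| := by fun_prop
  exact ((isOpen_lt h1 h2).inter (isOpen_lt h2 continuous_const)).measurableSet

theorem volume_cutCone_eq {d : ℕ} {e e' : E d} (he : ‖e‖ = ‖e'‖) (h : ℝ) :
    volume (cutCone e h) = volume (cutCone e' h) := by
  let ψ := (ℝ ∙ (e - e'))ᗮ.reflection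
  have hψ : ψ e = e' := Submodule.reflection_sub he
  have hpre : ψ ⁻¹' cutCone e' h = cutCone e h := by
    ext y
    simp only [cutCone, mem_preimage, mem_ofPred_eq, LinearIsometryEquiv.norm_map]
    rw [← hψ, LinearIsometryEquiv.inner_map_map]
  rw [← hpre, ψ.measurePreserving.measure_preimage (measurableSet_cutCone _ _).nullMeasurableSet]

/-- The splitting of the first coordinate. -/
def splitFirst (k : ℕ) : E (k + 1) ≃ᵐ ℝ × E k :=
  ((MeasurableEquiv.toLp 2 (Fin (k + 1) → ℝ)).symm.trans
    (MeasurableEquiv.piFinSuccAbove (fun _ => ℝ) 0)).trans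
    (MeasurableEquiv.prodCongr (MeasurableEquiv.refl ℝ) (MeasurableEquiv.toLp 2 (Fin k → ℝ)))

theorem measurePreserving_splitFirst (k : ℕ) : MeasurePreserving (splitFirst k) := by
  refine MeasurePreserving.trans (MeasurePreserving.trans
    (EuclideanSpace.volume_preserving_symm_measurableEquiv_toLp (Fin (k + 1)))
    (volume_preserving_piFinSuccAbove (fun _ => ℝ) 0)) ?_
  exact (MeasurePreserving.id volume).prod (EuclideanSpace.volume_preserving_symm_measurableEquiv_toLp (Fin k)).symm

theorem splitFirst_fst {k : ℕ} (y : E (k + 1)) : (splitFirst k y).1 = y 0 := rfl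

theorem norm_sq_splitFirst {k : ℕ} (y : E (k + 1)) :
    ‖y‖ ^ 2 = (splitFirst k y).1 ^ 2 + ‖(splitFirst k y).2‖ ^ 2 := by
  rw [EuclideanSpace.norm_sq_eq, EuclideanSpace.norm_sq_eq, Fin.sum_univ_succ]
  simp only [Real.norm_eq_abs, sq_abs]
  rfl

theorem volume_ball_succ_le (k : ℕ) :
    volume (Metric.ball (0 : E (k + 1)) 1) ≤ 2 * volume (Metric.ball (0 : E k) 1) := by
  have hsub : Metric.ball (0 : E (k + 1)) 1 ⊆
      splitFirst k ⁻¹' (Ioo (-1) 1 ×ˢ Metric.ball (0 : E k) 1) := by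
    intro y hy
    rw [mem_ball_zero_iff] at hy
    have h1 := norm_sq_splitFirst y
    have h2 : ‖y‖ ^ 2 < 1 := by nlinarith [norm_nonneg y]
    refine ⟨abs_lt.1 (abs_lt_of_sq_lt_sq (by nlinarith [sq_nonneg ‖(splitFirst k y).2‖]) zero_le_one), ?_⟩
    rw [mem_ball_zero_iff]
    exact lt_of_pow_lt_pow_left₀ 2 zero_le_one (by nlinarith [sq_nonneg (splitFirst k y).1])
  refine (measure_mono hsub).trans_eq ?_
  rw [(measurePreserving_splitFirst k).measure_preimage
    (measurableSet_Ioo.prod measurableSet_ball).nullMeasurableSet]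
  rw [Measure.volume_eq_prod, Measure.prod_prod, Real.volume_Ioo]
  norm_num

theorem lintegral_abs_pow (k : ℕ) {h : ℝ} (hh : 0 ≤ h) :
    ∫⁻ t in Ioo (-h) h, ENNReal.ofReal (|t| ^ k) = ENNReal.ofReal (2 * h ^ (k + 1) / (k + 1)) := by
  have hc : Continuous fun t : ℝ => |t| ^ k := by fun_prop
  rw [← ofReal_integral_eq_lintegral_ofReal
    ((hc.integrableOn_Icc (a := -h) (b := h)).mono_set Ioo_subset_Icc_self)
    (Filter.Eventually.of_forall fun t => by positivity)]
  congr 1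
  rw [← integral_Ioc_eq_integral_Ioo, ← intervalIntegral.integral_of_le (by linarith),
    ← intervalIntegral.integral_add_adjacent_intervals (b := 0) (hc.intervalIntegrable _ _)
      (hc.intervalIntegrable _ _)]
  have h1 : ∫ t in (0 : ℝ)..h, |t| ^ k = h ^ (k + 1) / (k + 1) := by
    have : ∫ t in (0 : ℝ)..h, |t| ^ k = ∫ t in (0 : ℝ)..h, t ^ k := by
      refine intervalIntegral.integral_congr fun t ht => ?_
      rw [uIcc_of_le hh] at ht
      simp only [abs_of_nonneg ht.1]
    rw [this, integral_pow]
    simp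
  have h2 : ∫ t in (-h)..0, |t| ^ k = ∫ t in (0 : ℝ)..h, |t| ^ k := by
    have := intervalIntegral.integral_comp_neg (fun t : ℝ => |t| ^ k) (a := 0) (b := h)
    simp only [abs_neg, neg_zero] at this
    exact this.symm
  rw [h2, h1]
  ring

theorem volume_cutCone {k : ℕ} (hk : 0 < k) {e : E (k + 1)} (he : ‖e‖ = 1) {h : ℝ} (h0 : 0 < h) (h1 : h ≤ 1) :
    volume (cutCone e h) = ENNReal.ofReal (2 * h * √(1 - h ^ 2) ^ k / (k + 1)) *
      volume (Metric.ball (0 : E k) 1) := by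
  rw [volume_cutCone_eq (e' := EuclideanSpace.single 0 1) (by rw [he]; simp)]
  set m := √(1 - h ^ 2) / h with hm
  have hs : √(1 - h ^ 2) ^ 2 = 1 - h ^ 2 := Real.sq_sqrt (by nlinarith)
  have hm0 : 0 ≤ m := div_nonneg (Real.sqrt_nonneg _) h0.le
  have hpre : cutCone (EuclideanSpace.single 0 1 : E (k + 1)) h = splitFirst k ⁻¹'
      {p | p.2 ∈ Metric.ball 0 (m * |p.1|) ∧ |p.1| < h} := by
    ext y
    simp only [cutCone, mem_preimage, mem_ofPred_eq, splitFirst_fst, mem_ball_zero_iff]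
    have : ⟪(EuclideanSpace.single 0 1 : E (k + 1)), y⟫ = y 0 := by
      simp [EuclideanSpace.inner_single_left]
    rw [this]
    refine and_congr_left fun _ => ?_
    have hn := norm_sq_splitFirst y
    rw [splitFirst_fst] at hn
    rw [← pow_lt_pow_iff_left₀ (by positivity) (by positivity) two_ne_zero,
      ← pow_lt_pow_iff_left₀ (norm_nonneg _) (by positivity) two_ne_zero,
      mul_pow, mul_pow, hn, sq_abs, hm, div_pow, hs, div_mul_eq_mul_div, lt_div_iff₀ (by positivity)]
    constructor <;> intro h <;> linarith
  have hmeas : MeasurableSet {p : ℝ × E k | p.2 ∈ Metric.ball 0 (m * |p.1|) ∧ |p.1| < h} := by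
    simp only [mem_ball_zero_iff]
    have c1 : Continuous fun p : ℝ × E k => ‖p.2‖ := by fun_prop
    have c2 : Continuous fun p : ℝ × E k => m * |p.1| := by fun_prop
    have c3 : Continuous fun p : ℝ × E k => |p.1| := by fun_prop
    exact ((isOpen_lt c1 c2).inter (isOpen_lt c3 continuous_const)).measurableSet
  rw [hpre, (measurePreserving_splitFirst k).measure_preimage hmeas.nullMeasurableSet,
    Measure.volume_eq_prod, Measure.prod_apply hmeas]
  have hslice : ∀ t : ℝ, volume (Prod.mk t ⁻¹'
      {p : ℝ × E k | p.2 ∈ Metric.ball 0 (m * |p.1|) ∧ |p.1| < h}) =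
      (Ioo (-h) h).indicator (fun t => ENNReal.ofReal (m ^ k) * ENNReal.ofReal (|t| ^ k) *
        volume (Metric.ball (0 : E k) 1)) t := by
    intro t
    by_cases ht : |t| < h
    · rw [indicator_of_mem (show t ∈ Ioo (-h) h from abs_lt.1 ht)]
      have : Prod.mk t ⁻¹' {p : ℝ × E k | p.2 ∈ Metric.ball 0 (m * |p.1|) ∧ |p.1| < h} =
          Metric.ball 0 (m * |t|) := by
        ext z
        simp only [mem_preimage, mem_ofPred_eq, ht, and_true]
      rw [this, ← ENNReal.ofReal_mul (by positivity), ← mul_pow]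
      have : Nonempty (Fin k) := ⟨⟨0, hk⟩⟩
      rw [Measure.addHaar_ball _ _ (by positivity)]
      simp
    · rw [indicator_of_notMem fun h' : t ∈ Ioo (-h) h => ht (abs_lt.2 h')]
      convert measure_empty (μ := (volume : Measure (E k)))
      ext z
      simp only [mem_preimage, mem_ofPred_eq, ht, and_false, mem_empty_iff_false]
  simp_rw [hslice]
  rw [lintegral_indicator measurableSet_Ioo, lintegral_mul_const _ (by fun_prop),
    lintegral_const_mul _ (by fun_prop), lintegral_abs_pow k h0.le,
    ← ENNReal.ofReal_mul (by positivity)]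
  congr 2
  rw [hm, div_pow]
  field_simp
  ring

theorem toSphere_hitting_ball_ge {k : ℕ} (hk : 0 < k) {x c : E (k + 1)} {h ρ : ℝ} (h0 : 0 < h)
    (h1 : h < 1) (hρ : 0 < ρ) (hx : ‖c - x‖ ^ 2 * (1 - h ^ 2) < ρ ^ 2) :
    (k + 1 : ℕ) * (ENNReal.ofReal (2 * h * √(1 - h ^ 2) ^ k / (k + 1)) *
      volume (Metric.ball (0 : E k) 1)) ≤
    (volume : Measure (E (k + 1))).toSphere
      {u | lineThrough (u, x) ∈ hitting (Metric.ball c ρ)} := by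
  obtain ⟨e, he, hce⟩ : ∃ e : E (k + 1), ‖e‖ = 1 ∧ c - x = ‖c - x‖ • e := by
    by_cases h : c - x = 0
    · exact ⟨EuclideanSpace.single 0 1, by simp, by simp [h]⟩
    · refine ⟨‖c - x‖⁻¹ • (c - x), by rw [norm_smul, norm_inv, norm_norm, inv_mul_cancel₀ (norm_ne_zero_iff.2 h)], ?_⟩
      rw [smul_smul, mul_inv_cancel₀ (norm_ne_zero_iff.2 h), one_smul]
  rw [← volume_cutCone hk he h0 h1.le]
  have hmeas : MeasurableSet {u : Metric.sphere (0 : E (k + 1)) 1 |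
      lineThrough (u, x) ∈ hitting (Metric.ball c ρ)} :=
    measurable_prodMk_right (measurable_lineThrough (measurableSet_hitting Metric.isOpen_ball))
  rw [Measure.toSphere_apply' _ hmeas, finrank_euclideanSpace_fin]
  gcongr
  intro y hy
  have hy1 : 0 < ‖y‖ := by
    rw [norm_pos_iff]
    rintro rfl
    have := hy.1
    simp at this
  have hy2 : ‖y‖ < 1 := by
    have := hy.1.trans hy.2
    nlinarith
  have hu : ‖‖y‖⁻¹ • y‖ = 1 := by
    rw [norm_smul, norm_inv, norm_norm, inv_mul_cancel₀ hy1.ne']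
  refine Set.mem_smul.2 ⟨‖y‖, ⟨hy1, hy2⟩, ‖y‖⁻¹ • y, ⟨⟨_, mem_sphere_zero_iff_norm.2 hu⟩, ?_, rfl⟩,
    by rw [smul_smul, mul_inv_cancel₀ hy1.ne', one_smul]⟩
  rw [mem_ofPred_eq, lineThrough_mem_hitting_iff]
  set u := ‖y‖⁻¹ • y with hu_def
  have hue : h < |⟪e, u⟫| := by
    rw [hu_def, inner_smul_right, abs_mul, abs_inv, abs_norm, lt_inv_mul_iff₀ hy1, mul_comm]
    exact hy.1
  have hue2 : h ^ 2 < ⟪e, u⟫ ^ 2 := by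
    rw [← sq_abs ⟪e, u⟫]
    gcongr
  refine ⟨⟪c - x, u⟫, ?_⟩
  rw [mem_ball_iff_norm]
  refine lt_of_pow_lt_pow_left₀ 2 hρ.le (lt_of_le_of_lt ?_ hx)
  have : x + ⟪c - x, u⟫ • u - c = ⟪c - x, u⟫ • u - (c - x) := by abel
  change ‖x + ⟪c - x, u⟫ • u - c‖ ^ 2 ≤ _
  rw [this, norm_sub_sq_real, norm_smul, hu, inner_smul_left, real_inner_comm (c - x) u]
  have h3 : ⟪c - x, u⟫ = ‖c - x‖ * ⟪e, u⟫ := by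
    conv_lhs => rw [hce, inner_smul_left]
    simp
  rw [h3]
  simp only [mul_one, Real.norm_eq_abs, sq_abs, conj_trivial]
  nlinarith [sq_nonneg ‖c - x‖]

theorem volume_ball_two_le :
    volume (Metric.ball (0 : E 2) 1) ≤
      ENNReal.ofReal (7 / 4) * volume (Metric.ball (0 : E 1) 1) := by
  rw [EuclideanSpace.volume_ball, EuclideanSpace.volume_ball]
  simp only [ENNReal.ofReal_one, one_pow, one_mul, Fintype.card_fin, Nat.cast_ofNat, Nat.cast_one,
    pow_one]
  rw [← ENNReal.ofReal_mul (by norm_num)]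
  apply ENNReal.ofReal_le_ofReal
  rw [Real.Gamma_add_one (by norm_num), Real.Gamma_add_one (by norm_num), Real.Gamma_one_half_eq,
    Real.sq_sqrt Real.pi_pos.le]
  have h := Real.pi_lt_d2
  have h2 : √Real.pi ≠ 0 := (Real.sqrt_pos.2 Real.pi_pos).ne'
  norm_num
  field_simp
  linarith

theorem two_mul_succ_le_pow {k : ℕ} (hk : 2 ≤ k) :
    (2 : ℝ) * (k + 1) ≤ 2 * (15 / 16) * (15 / 8) ^ k := by
  induction k, hk using Nat.le_induction with
  | base => norm_num
  | succ n hn ih =>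
    have hn' : (2 : ℝ) ≤ n := by exact_mod_cast hn
    push_cast
    rw [pow_succ]
    linarith

theorem volume_ball_succ_mul_le {k : ℕ} (hk : 0 < k) {α : ℝ} (hα : 2 ≤ α) :
    ENNReal.ofReal ((4 * α)⁻¹ ^ k) * volume (Metric.ball (0 : E (k + 1)) 1) ≤
      ENNReal.ofReal (2 * √(1 - (2 * α + 1 / 4)⁻¹ ^ 2) * (2 * α + 1 / 4)⁻¹ ^ k / (k + 1)) *
        volume (Metric.ball (0 : E k) 1) := by
  set q := 2 * α + 1 / 4 with hq
  have hq0 : 0 < q := by positivity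
  set h := √(1 - q⁻¹ ^ 2)
  have hh : 15 / 16 ≤ h := by
    apply Real.le_sqrt_of_sq_le
    have : q⁻¹ ≤ 1 / 4 := by
      rw [inv_le_comm₀ hq0 (by norm_num)]; norm_num; linarith
    have h0 : 0 ≤ q⁻¹ := by positivity
    nlinarith
  have key : (15 / 8) ^ k * (4 * α)⁻¹ ^ k ≤ q⁻¹ ^ k := by
    rw [← mul_pow]
    refine pow_le_pow_left₀ (by positivity) ?_ _
    rw [← div_eq_mul_inv, div_le_iff₀ (by positivity), inv_mul_eq_div, le_div_iff₀ hq0]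
    linarith
  obtain ⟨C, hC, hvol, hCk⟩ : ∃ C : ℝ, 0 ≤ C ∧ volume (Metric.ball (0 : E (k + 1)) 1) ≤
      ENNReal.ofReal C * volume (Metric.ball (0 : E k) 1) ∧
      C * (k + 1) ≤ 2 * (15 / 16) * (15 / 8) ^ k := by
    obtain rfl | hk2 : k = 1 ∨ 2 ≤ k := by omega
    · exact ⟨7 / 4, by norm_num, volume_ball_two_le, by norm_num⟩
    · refine ⟨2, by norm_num, by simpa using volume_ball_succ_le k, ?_⟩
      exact two_mul_succ_le_pow hk2
  calc _ ≤ ENNReal.ofReal ((4 * α)⁻¹ ^ k) * (ENNReal.ofReal C *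
        volume (Metric.ball (0 : E k) 1)) := by gcongr
    _ = ENNReal.ofReal ((4 * α)⁻¹ ^ k * C) * volume (Metric.ball (0 : E k) 1) := by
        rw [← mul_assoc, ENNReal.ofReal_mul (by positivity)]
    _ ≤ _ := by
        gcongr
        rw [le_div_iff₀ (by positivity)]
        calc (4 * α)⁻¹ ^ k * C * (k + 1) = (C * (k + 1)) * (4 * α)⁻¹ ^ k := by ring
          _ ≤ (2 * (15 / 16) * (15 / 8) ^ k) * (4 * α)⁻¹ ^ k := by gcongr
          _ = 2 * (15 / 16) * ((15 / 8) ^ k * (4 * α)⁻¹ ^ k) := by ring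
          _ ≤ 2 * h * q⁻¹ ^ k := by gcongr

/-- The solid angle of a ball of radius `ρ` from a point at distance less than
`(2 * α + 1 / 4) * ρ` of its centre is at least `(4 * α) ^ (1 - d)`. -/
theorem toSphere_hitting_ball_ge_of_dist {d : ℕ} (hd : 2 ≤ d) {α ρ : ℝ} (hα : 2 ≤ α) (hρ : 0 < ρ)
    {x c : E d} (hx : dist x c < (2 * α + 1 / 4) * ρ) :
    ENNReal.ofReal ((4 * α)⁻¹ ^ (d - 1)) * (volume : Measure (E d)).toSphere univ ≤
      (volume : Measure (E d)).toSphere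
        {u | lineThrough (u, x) ∈ hitting (Metric.ball c ρ)} := by
  obtain ⟨k, rfl⟩ : ∃ k, d = k + 1 := ⟨d - 1, by omega⟩
  have hk : 0 < k := by omega
  have hq : 0 < 2 * α + 1 / 4 := by positivity
  have hq1 : (2 * α + 1 / 4)⁻¹ ^ 2 < 1 := by
    refine pow_lt_one₀ (by positivity) (inv_lt_one_of_one_lt₀ (by linarith)) two_ne_zero
  have hs : √(1 - (2 * α + 1 / 4)⁻¹ ^ 2) ^ 2 = 1 - (2 * α + 1 / 4)⁻¹ ^ 2 :=
    Real.sq_sqrt (by linarith)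
  refine le_trans ?_ (toSphere_hitting_ball_ge hk (h := √(1 - (2 * α + 1 / 4)⁻¹ ^ 2))
    (Real.sqrt_pos.2 (by linarith)) ?_ hρ ?_)
  · rw [Measure.toSphere_apply_univ, finrank_euclideanSpace_fin, hs, sub_sub_cancel,
      Real.sqrt_sq (by positivity), mul_left_comm]
    exact mul_le_mul_right (volume_ball_succ_mul_le hk hα) _
  · rw [Real.sqrt_lt' one_pos]
    have : 0 < (2 * α + 1 / 4)⁻¹ ^ 2 := by positivity
    linarith
  · rw [hs, sub_sub_cancel, ← mul_pow, ← dist_eq_norm, dist_comm]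
    refine pow_lt_pow_left₀ ?_ (by positivity) two_ne_zero
    rwa [← div_eq_mul_inv, div_lt_iff₀ hq, mul_comm]

/-! ### Many lines join two balls and avoid a set of small solid angle -/

theorem toSphere_ne_top {d : ℕ} (s : Set (Metric.sphere (0 : E d) 1)) :
    (volume : Measure (E d)).toSphere s ≠ ∞ := measure_ne_top _ _

theorem toSphere_univ_ne_zero {d : ℕ} (hd : 2 ≤ d) :
    (volume : Measure (E d)).toSphere univ ≠ 0 := by
  rw [Measure.toSphere_apply_univ, finrank_euclideanSpace_fin]
  exact mul_ne_zero (by exact_mod_cast (by omega : d ≠ 0))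
    (Metric.measure_ball_pos _ _ one_pos).ne'

theorem toSphere_lt_of_solidAngle_lt {d : ℕ} (hd : 2 ≤ d) {F : Set (E d)} {x : E d} {Θ : ℝ}
    (h : solidAngle F x < ENNReal.ofReal Θ) :
    (volume : Measure (E d)).toSphere {u | lineThrough (u, x) ∈ hitting F} ≤
      ENNReal.ofReal Θ * (volume : Measure (E d)).toSphere univ := by
  rw [solidAngle] at h
  exact ((ENNReal.div_lt_iff (Or.inl (toSphere_univ_ne_zero hd))
    (Or.inl (toSphere_ne_top _))).1 h).le

theorem exists_measurableSet_lines_avoiding {d : ℕ} (hd : 2 ≤ d) {α Θ : ℝ} (hα : 2 ≤ α)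
    (hΘ0 : 0 < Θ) (hΘ : Θ < (4 * α)⁻¹ ^ (d - 1)) :
    ∃ κ : ℝ, 0 < κ ∧ ∀ (ρ : ℝ) (b c : E d) (F : Set (E d)), 0 < ρ → dist b c < 2 * α * ρ →
      NullMeasurableSet (hitting F) (lineMeasure d) →
      (∀ x ∈ Metric.ball b ρ, solidAngle F x < ENNReal.ofReal Θ) →
      ∃ G : Set (Line d), MeasurableSet G ∧ G ⊆ hitting (Metric.ball b ρ) ∧
        G ⊆ hitting (Metric.ball c ρ) ∧ Disjoint G (hitting F) ∧
        ENNReal.ofReal (κ * ρ ^ (d - 1)) ≤ lineMeasure d G := by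
  set σ := (volume : Measure (E d)).toSphere with hσ
  set Φ := (4 * α)⁻¹ ^ (d - 1) with hΦ
  have : Nonempty (Fin d) := ⟨⟨0, by omega⟩⟩
  have hvol0 : volume (Metric.ball (0 : E d) 1) ≠ 0 := (Metric.measure_ball_pos _ _ one_pos).ne'
  have hvolt : volume (Metric.ball (0 : E d) 1) ≠ ∞ := measure_ball_lt_top.ne
  have hD0 : 2 * volume (Metric.ball (0 : E (d - 1)) 1) ≠ 0 :=
    mul_ne_zero two_ne_zero (Metric.measure_ball_pos _ _ one_pos).ne'
  have hDt : 2 * volume (Metric.ball (0 : E (d - 1)) 1) ≠ ∞ :=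
    ENNReal.mul_ne_top ENNReal.ofNat_ne_top measure_ball_lt_top.ne
  have hC0 : ENNReal.ofReal (Φ - Θ) * σ univ * volume (Metric.ball (0 : E d) 1) ≠ 0 :=
    mul_ne_zero (mul_ne_zero (ENNReal.ofReal_pos.2 (sub_pos.2 hΘ)).ne' (toSphere_univ_ne_zero hd))
      hvol0
  have hCt : ENNReal.ofReal (Φ - Θ) * σ univ * volume (Metric.ball (0 : E d) 1) ≠ ∞ :=
    ENNReal.mul_ne_top (ENNReal.mul_ne_top ENNReal.ofReal_ne_top (toSphere_ne_top _)) hvolt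
  set C := (ENNReal.ofReal (Φ - Θ) * σ univ * volume (Metric.ball (0 : E d) 1)).toReal with hC
  set D := (2 * volume (Metric.ball (0 : E (d - 1)) 1)).toReal with hD
  have hCpos : 0 < C := ENNReal.toReal_pos hC0 hCt
  have hDpos : 0 < D := ENNReal.toReal_pos hD0 hDt
  refine ⟨C / (2 * D) * (1 / 4) ^ (d - 1), by positivity, ?_⟩
  intro ρ b c F hρ hbc hF hsolid
  obtain ⟨M, hMF, hM, hMae⟩ := hF.exists_measurable_subset_ae_eq
  set G := (hitting (Metric.ball b ρ) ∩ hitting (Metric.ball c ρ)) \ M with hG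
  have hGm : MeasurableSet G := ((measurableSet_hitting Metric.isOpen_ball).inter
    (measurableSet_hitting Metric.isOpen_ball)).diff hM
  set Z := toMeasurable (lineMeasure d) (hitting F \ M) with hZ
  have hZ0 : lineMeasure d Z = 0 := by
    rw [hZ, measure_toMeasurable]
    exact ae_le_set.1 hMae.symm.le
  refine ⟨G \ Z, hGm.diff (measurableSet_toMeasurable _ _), fun l hl => hl.1.1.1,
    fun l hl => hl.1.1.2, ?_, ?_⟩
  · rw [Set.disjoint_left]
    intro l hl hlF
    exact hl.2 (subset_toMeasurable _ _ ⟨hlF, hl.1.2⟩)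
  rw [measure_sdiff_null hZ0]
  have hpoint : ∀ x ∈ Metric.ball b (ρ / 4),
      ENNReal.ofReal (Φ - Θ) * σ univ ≤ σ {u | lineThrough (u, x) ∈ G} := by
    intro x hx
    have hxρ : x ∈ Metric.ball b ρ := Metric.ball_subset_ball (by linarith) hx
    have h1 := toSphere_hitting_ball_ge_of_dist hd hα hρ (x := x) (c := c) (by
      have := dist_triangle x b c
      have := Metric.mem_ball.1 hx
      linarith)
    have h2 : σ {u | lineThrough (u, x) ∈ hitting (Metric.ball c ρ)} ≤
        σ {u | lineThrough (u, x) ∈ G} + ENNReal.ofReal Θ * σ univ := by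
      refine (measure_mono (t := {u | lineThrough (u, x) ∈ G} ∪
        {u | lineThrough (u, x) ∈ hitting F}) ?_).trans ((measure_union_le _ _).trans
          (add_le_add_right (toSphere_lt_of_solidAngle_lt hd (hsolid x hxρ)) _))
      intro u hu
      by_cases hMu : lineThrough (u, x) ∈ M
      · exact Or.inr (hMF hMu)
      · exact Or.inl ⟨⟨lineThrough_mem_hitting_iff.2 ⟨0, by simpa using hxρ⟩, hu⟩, hMu⟩
    have h3 := h1.trans h2
    rw [← hΦ, show Φ = (Φ - Θ) + Θ by ring, ENNReal.ofReal_add (sub_pos.2 hΘ).le hΘ0.le,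
      add_mul] at h3
    exact (ENNReal.add_le_add_iff_right
      (ENNReal.mul_ne_top ENNReal.ofReal_ne_top (toSphere_ne_top _))).1 h3
  have h4 : ENNReal.ofReal (Φ - Θ) * σ univ * volume (Metric.ball b (ρ / 4)) ≤
      ENNReal.ofReal (2 * (ρ / 4)) * (2 * volume (Metric.ball (0 : E (d - 1)) 1)) *
        lineMeasure d G := by
    refine le_trans ?_ (lintegral_toSphere_le_lineMeasure hGm b (ρ / 4))
    rw [← setLIntegral_const]
    exact setLIntegral_mono' measurableSet_ball hpoint
  rw [Measure.addHaar_ball _ _ (by positivity), finrank_euclideanSpace_fin, mul_left_comm,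
    ← ENNReal.ofReal_toReal hCt, ← ENNReal.ofReal_toReal hDt, ← hC, ← hD,
    ← ENNReal.ofReal_mul (by positivity), ← ENNReal.ofReal_mul (by positivity)] at h4
  have h5 := ENNReal.div_le_of_le_mul' h4
  rw [← ENNReal.ofReal_div_of_pos (by positivity)] at h5
  refine le_trans (ENNReal.ofReal_le_ofReal (le_of_eq ?_)) h5
  obtain ⟨k, rfl⟩ : ∃ k, d = k + 1 := ⟨d - 1, by omega⟩
  rw [Nat.add_sub_cancel, div_pow, div_pow, one_pow, pow_succ, pow_succ]
  field_simp

/-! ### Void probabilities -/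

theorem IsPoissonProcess.measure_void_le {Ω X : Type*} [MeasurableSpace Ω] [MeasurableSpace X]
    {P : Measure Ω} [IsProbabilityMeasure P] {N : Ω → Set X} {Λ : Measure X}
    (hN : IsPoissonProcess P N Λ) {B : Set X} (hB : MeasurableSet B) {a : ℝ}
    (ha : ENNReal.ofReal a ≤ Λ B) :
    P {ω | N ω ∩ B = ∅} ≤ ENNReal.ofReal (Real.exp (-a)) := by
  have hset : {ω | N ω ∩ B = ∅} = (fun ω => (N ω ∩ B).encard) ⁻¹' {0} := by
    ext ω
    simp [Set.encard_eq_zero]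
  by_cases hΛ : Λ B = ∞
  · have h0 : P {ω | N ω ∩ B = ∅} = 0 := by
      have := hN.count_eq_top B hB hΛ
      refine measure_mono_null ?_ (ae_iff.1 this)
      intro ω hω
      rw [mem_ofPred_eq] at hω
      simp [hω]
    rw [h0]
    exact zero_le
  · have hm := hN.measurable_count B hB
    rw [hset, ← Measure.map_apply hm (measurableSet_singleton _), hN.law_count B hB hΛ,
      Measure.map_apply (by fun_prop) (measurableSet_singleton _)]
    have hpre : (fun n : ℕ => (n : ℕ∞)) ⁻¹' {0} = {0} := by
      ext n; simp
    rw [hpre, poissonMeasure_singleton]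
    apply ENNReal.ofReal_le_ofReal
    have : a ≤ (Λ B).toReal := (ENNReal.ofReal_le_iff_le_toReal hΛ).1 ha
    simp
    exact this

theorem speedMeasure_Ici {γ v : ℝ} (hγ : 1 < γ) (hv : 0 < v) :
    speedMeasure γ (Ici v) = ENNReal.ofReal (v ^ (1 - γ)) := by
  rw [speedMeasure, withDensity_apply _ measurableSet_Ici,
    Measure.restrict_restrict measurableSet_Ici,
    inter_eq_self_of_subset_left (Ici_subset_Ioi.2 hv), ← restrict_Ioi_eq_restrict_Ici,
    ← ofReal_integral_eq_lintegral_ofReal, integral_const_mul,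
    integral_Ioi_rpow_of_lt (by linarith) hv]
  · congr 1
    rw [show -γ + 1 = 1 - γ by ring]
    have : 1 - γ ≠ 0 := by linarith
    field_simp
    ring
  · exact (integrableOn_Ioi_rpow_of_lt (by linarith) hv).const_mul _
  · rw [Filter.EventuallyLE, ae_restrict_iff' measurableSet_Ioi]
    refine Filter.Eventually.of_forall fun x hx => ?_
    have : 0 < x := hv.trans hx
    have : 0 < γ - 1 := by linarith
    simp only [Pi.zero_apply]
    positivity

theorem sFinite_speedMeasure (γ : ℝ) : SFinite (speedMeasure γ) := by
  unfold speedMeasure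
  infer_instance

theorem IsPoissonProcess.measure_no_fast_line_le {d : ℕ} {Ω : Type*} [MeasurableSpace Ω]
    {P : Measure Ω} [IsProbabilityMeasure P] {N : Ω → Set (Line d × ℝ)} {γ : ℝ} (hγ : 1 < γ)
    (hN : IsPoissonProcess P N (markedLineMeasure d γ)) {G : Set (Line d)} (hG : MeasurableSet G)
    {a v : ℝ} (ha0 : 0 ≤ a) (ha : ENNReal.ofReal a ≤ lineMeasure d G) (hv : 0 < v) :
    P {ω | ¬ ∃ m ∈ N ω, m.1 ∈ G ∧ v ≤ m.2} ≤ ENNReal.ofReal (Real.exp (-(a * v ^ (1 - γ)))) := by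
  have := sFinite_speedMeasure γ
  refine le_trans (measure_mono ?_) (hN.measure_void_le (hG.prod (measurableSet_Ici (a := v)))
    (a := a * v ^ (1 - γ)) ?_)
  · intro ω hω
    rw [mem_ofPred_eq] at hω ⊢
    rw [eq_empty_iff_forall_notMem]
    exact fun m hm => hω ⟨m, hm.1, hm.2.1, hm.2.2⟩
  · rw [markedLineMeasure, Measure.prod_prod, speedMeasure_Ici hγ hv, ENNReal.ofReal_mul ha0]
    gcongr

/-! ### Coverings by balls -/

theorem card_le_of_separated {d : ℕ} {a : E d} {ρ s : ℝ} (hρ : 0 < ρ) (hs : 0 < s)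
    {t : Finset (E d)} (ht : ∀ b ∈ t, b ∈ Metric.ball a ρ)
    (hsep : ∀ b ∈ t, ∀ c ∈ t, b ≠ c → s ≤ dist b c) : (t.card : ℝ) ≤ (2 * (ρ / s) + 1) ^ d := by
  have hdisj : (t : Set (E d)).PairwiseDisjoint fun b => Metric.ball b (s / 2) := by
    intro b hb c hc hbc
    refine Metric.ball_disjoint_ball ?_
    linarith [hsep b hb c hc hbc]
  have hsub : (⋃ b ∈ t, Metric.ball b (s / 2)) ⊆ Metric.ball a (ρ + s / 2) := by
    refine iUnion₂_subset fun b hb => ?_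
    refine Metric.ball_subset_ball' ?_
    have := Metric.mem_ball.1 (ht b hb)
    linarith
  have hvol := measure_mono (μ := (volume : Measure (E d))) hsub
  rw [measure_biUnion_finset hdisj fun b _ => measurableSet_ball] at hvol
  have hb : ∀ b : E d, ∀ x : ℝ, 0 < x → volume (Metric.ball b x) =
      ENNReal.ofReal (x ^ d) * volume (Metric.ball (0 : E d) 1) := by
    intro b x hx
    rw [Measure.addHaar_ball_of_pos _ _ hx, finrank_euclideanSpace_fin]
  simp_rw [hb _ _ (half_pos hs), hb a _ (by positivity : 0 < ρ + s / 2)] at hvol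
  rw [Finset.sum_const, nsmul_eq_mul, ← mul_assoc,
    ENNReal.mul_le_mul_iff_left (Metric.measure_ball_pos _ _ one_pos).ne'
      measure_ball_lt_top.ne, ← ENNReal.ofReal_natCast, ← ENNReal.ofReal_mul (by positivity),
    ENNReal.ofReal_le_ofReal_iff (by positivity), ← le_div_iff₀ (by positivity), ← div_pow] at hvol
  refine hvol.trans_eq ?_
  congr 1
  field_simp

theorem exists_finset_cover {d : ℕ} {S : Set (E d)} {a : E d} {ρ s : ℝ} (hρ : 0 < ρ) (hs : 0 < s)
    (hS : S ⊆ Metric.ball a ρ) :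
    ∃ t : Finset (E d), (∀ b ∈ t, b ∈ S) ∧ (∀ x ∈ S, ∃ b ∈ t, x ∈ Metric.ball b s) ∧
      (t.card : ℝ) ≤ (2 * (ρ / s) + 1) ^ d := by
  classical
  let Good : ℕ → Prop := fun n => ∃ t : Finset (E d), t.card = n ∧ (∀ b ∈ t, b ∈ S) ∧
    ∀ b ∈ t, ∀ c ∈ t, b ≠ c → s ≤ dist b c
  have hbound : ∀ n, Good n → n ≤ ⌊(2 * (ρ / s) + 1) ^ d⌋₊ := by
    rintro n ⟨t, rfl, htS, hsep⟩
    exact Nat.le_floor (card_le_of_separated hρ hs (fun b hb => hS (htS b hb)) hsep)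
  have h0 : Good 0 := ⟨∅, rfl, by simp, by simp⟩
  obtain ⟨t, htc, htS, hsep⟩ := Nat.findGreatest_spec (P := Good) (hbound 0 h0) h0
  refine ⟨t, htS, fun x hx => ?_, card_le_of_separated hρ hs (fun b hb => hS (htS b hb)) hsep⟩
  by_contra hcon
  push Not at hcon
  have hxt : x ∉ t := fun h => hcon x h (Metric.mem_ball_self hs)
  have hgood : Good (t.card + 1) := by
    refine ⟨insert x t, Finset.card_insert_of_notMem hxt, ?_, ?_⟩
    · intro b hb
      rcases Finset.mem_insert.1 hb with rfl | hb
      exacts [hx, htS b hb]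
    · intro b hb c hc hbc
      rcases Finset.mem_insert.1 hb with hb' | hb' <;> rcases Finset.mem_insert.1 hc with hc' | hc'
      · exact absurd (hb'.trans hc'.symm) hbc
      · rw [hb']
        exact not_lt.1 fun h => hcon c hc' h
      · rw [hc', dist_comm]
        exact not_lt.1 fun h => hcon b hb' h
      · exact hsep b hb' c hc' hbc
  have := Nat.le_findGreatest (hbound _ hgood) hgood
  omega

/-! ### The hierarchy of cells -/

open Classical in
/-- The cells of level `k`: those of level `k + 1` are the balls of radius `ρ (k + 1)` around the
points of the finite sets `cov k S`, for the cells `S` of level `k`. -/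
def cells {d : ℕ} (S₀ : Finset (Set (E d))) (cov : ℕ → Set (E d) → Finset (E d)) (ρ : ℕ → ℝ) :
    ℕ → Finset (Set (E d))
  | 0 => S₀
  | k + 1 => (cells S₀ cov ρ k).biUnion fun S =>
      (cov k S).image fun b => Metric.ball b (ρ (k + 1))

theorem mem_cells_succ {d : ℕ} {S₀ : Finset (Set (E d))} {cov : ℕ → Set (E d) → Finset (E d)}
    {ρ : ℕ → ℝ} {k : ℕ} {S' : Set (E d)} : S' ∈ cells S₀ cov ρ (k + 1) ↔
      ∃ S ∈ cells S₀ cov ρ k, ∃ b ∈ cov k S, Metric.ball b (ρ (k + 1)) = S' := by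
  classical
  simp [cells]

theorem card_cells_le {d : ℕ} {S₀ : Finset (Set (E d))} {cov : ℕ → Set (E d) → Finset (E d)}
    {ρ : ℕ → ℝ} {K : ℝ} (hcov : ∀ k S, S ∈ cells S₀ cov ρ k → ((cov k S).card : ℝ) ≤ K) (k : ℕ) :
    ((cells S₀ cov ρ k).card : ℝ) ≤ S₀.card * K ^ k := by
  classical
  induction k with
  | zero => simp [cells]
  | succ k ih =>
    by_cases hne : (cells S₀ cov ρ k).Nonempty
    · obtain ⟨S, hS⟩ := hne
      have hK : 0 ≤ K := (Nat.cast_nonneg _).trans (hcov k S hS)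
      calc ((cells S₀ cov ρ (k + 1)).card : ℝ)
          ≤ ∑ S ∈ cells S₀ cov ρ k, (((cov k S).image fun b => Metric.ball b (ρ (k + 1))).card : ℝ) := by
            exact_mod_cast Finset.card_biUnion_le
        _ ≤ ∑ S ∈ cells S₀ cov ρ k, K := Finset.sum_le_sum fun S hS =>
            (Nat.cast_le.2 Finset.card_image_le).trans (hcov k S hS)
        _ = (cells S₀ cov ρ k).card * K := by rw [Finset.sum_const, nsmul_eq_mul]
        _ ≤ (S₀.card * K ^ k) * K := by gcongr
        _ = _ := by ring
    · have h1 : cells S₀ cov ρ (k + 1) = ∅ := by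
        rw [Finset.not_nonempty_iff_eq_empty] at hne
        simp [cells, hne]
      rw [h1]
      by_cases h0 : S₀ = ∅
      · simp [h0]
      · have h2 : ∃ S, S ∈ cells S₀ cov ρ 0 := Finset.nonempty_of_ne_empty h0
        obtain ⟨S, hS⟩ := h2
        have hK : 0 ≤ K := (Nat.cast_nonneg _).trans (hcov 0 S hS)
        simp only [Finset.card_empty, Nat.cast_zero]
        positivity

/-- The total time of a hierarchy of segments in which `2 ^ j` segments of level `j` are followed,
starting at level `k`. -/
def totalTime (t : ℕ → ℝ) (k : ℕ) : ℝ := ∑' j, 2 ^ j * t (k + j)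

theorem summable_totalTime {t : ℕ → ℝ} (hs : Summable fun k => 2 ^ k * t k) (k : ℕ) :
    Summable fun j => 2 ^ j * t (k + j) := by
  refine (((summable_nat_add_iff k).2 hs).mul_left (2 ^ k : ℝ)⁻¹).congr fun j => ?_
  rw [pow_add, add_comm j k]
  field_simp

theorem totalTime_eq {t : ℕ → ℝ} (hs : Summable fun k => 2 ^ k * t k) (k : ℕ) :
    totalTime t k = totalTime t (k + 1) + (t k + totalTime t (k + 1)) := by
  have h1 : totalTime t k = t k + ∑' j, 2 ^ (j + 1) * t (k + (j + 1)) := by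
    rw [totalTime, (summable_totalTime hs k).tsum_eq_zero_add]
    simp
  have h2 : ∑' j, 2 ^ (j + 1) * t (k + (j + 1)) = 2 * totalTime t (k + 1) := by
    rw [totalTime, ← tsum_mul_left]
    congr 1; funext j
    rw [show k + 1 + j = k + (j + 1) by omega, pow_succ]
    ring
  rw [h1, h2]
  ring

theorem le_totalTime {t : ℕ → ℝ} (ht : ∀ k, 0 < t k) (hs : Summable fun k => 2 ^ k * t k) (k : ℕ) :
    t k ≤ totalTime t k := by
  have := (summable_totalTime hs k).le_tsum 0 fun j _ => by have := ht (k + j); positivity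
  simpa [totalTime] using this

theorem tendsto_totalTime {t : ℕ → ℝ} :
    Filter.Tendsto (fun n => 2 ^ n * totalTime t n) Filter.atTop (nhds 0) := by
  refine (tendsto_sum_nat_add fun k => 2 ^ k * t k).congr fun n => ?_
  rw [totalTime, ← tsum_mul_left]
  congr 1; funext j
  rw [add_comm j n, pow_add]
  ring

theorem exists_connects_of_cells {d : ℕ} {Γ : Set (Line d × ℝ)} {S₀ : Finset (Set (E d))}
    {cov : ℕ → Set (E d) → Finset (E d)} {ρ v t : ℕ → ℝ}
    (hρ : ∀ k, 0 < ρ k) (hρanti : Antitone ρ) (hρsum : Summable ρ)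
    (hball : ∀ k, ∀ S ∈ cells S₀ cov ρ k, ∃ a, S ⊆ Metric.ball a (ρ k))
    (hcovS : ∀ k, ∀ S ∈ cells S₀ cov ρ k, ∀ b ∈ cov k S, b ∈ S)
    (hcov : ∀ k, ∀ S ∈ cells S₀ cov ρ k, ∀ x ∈ S, ∃ b ∈ cov k S, x ∈ Metric.ball b (ρ (k + 1)))
    (hv : ∀ k, 0 < v k) (hvanti : Antitone v) (ht : ∀ k, t k = 4 * ρ k / v k)
    (hs : Summable fun k => 2 ^ k * t k)
    (hΓ : ∀ k, ∀ S ∈ cells S₀ cov ρ k, ∀ b ∈ cov k S, ∀ c ∈ cov k S,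
      ∃ m ∈ Γ, m.1 ∈ hitting (Metric.ball b (ρ (k + 1))) ∧
        m.1 ∈ hitting (Metric.ball c (ρ (k + 1))) ∧ v k ≤ m.2)
    {S : Set (E d)} (hS : S ∈ S₀) {x y : E d} (hx : x ∈ S) (hy : y ∈ S) :
    ∃ ξ, Connects Γ ⟨v 0, (hv 0).le⟩ (totalTime t 0) ξ x y := by
  have htpos : ∀ k, 0 < t k := fun k => by
    rw [ht]
    have := hρ k
    have := hv k
    positivity
  let R : ℕ → E d → E d → Prop := fun k x y => ∃ S ∈ cells S₀ cov ρ k, x ∈ S ∧ y ∈ S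
  have hdist : ∀ k x y, R k x y → dist x y ≤ 2 * ρ k := by
    rintro k x y ⟨S, hS, hx, hy⟩
    obtain ⟨a, ha⟩ := hball k S hS
    have h1 := Metric.mem_ball.1 (ha hx)
    have h2 := Metric.mem_ball'.1 (ha hy)
    linarith [dist_triangle x a y]
  have hstep : ∀ k x y, ∃ p q, R k x y → R (k + 1) x p ∧ R (k + 1) q y ∧ dist p q ≤ 4 * ρ k ∧
      ∃ m ∈ Γ, p ∈ m.1.1 ∧ q ∈ m.1.1 ∧ v k ≤ m.2 := by
    intro k x y
    by_cases hR : R k x y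
    · obtain ⟨S, hS, hx, hy⟩ := hR
      obtain ⟨b, hb, hxb⟩ := hcov k S hS x hx
      obtain ⟨c, hc, hyc⟩ := hcov k S hS y hy
      obtain ⟨m, hm, ⟨p, hpm, hp⟩, ⟨q, hqm, hq⟩, hvm⟩ := hΓ k S hS b hb c hc
      refine ⟨p, q, fun _ => ⟨⟨_, mem_cells_succ.2 ⟨S, hS, b, hb, rfl⟩, hxb, hp⟩,
        ⟨_, mem_cells_succ.2 ⟨S, hS, c, hc, rfl⟩, hq, hyc⟩, ?_, m, hm, hpm, hqm, hvm⟩⟩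
      have h1 := hdist k b c ⟨S, hS, hcovS k S hS b hb, hcovS k S hS c hc⟩
      have h2 := Metric.mem_ball.1 hp
      have h3 := Metric.mem_ball'.1 hq
      have h4 : ρ (k + 1) ≤ ρ k := hρanti (Nat.le_succ k)
      linarith [dist_triangle4 p b c q]
    · exact ⟨x, y, fun h => absurd h hR⟩
  choose P Q hPQ using hstep
  have hvt : ∀ k, 4 * ρ k = v k * t k := fun k => by
    rw [ht, mul_div_cancel₀ _ (hv k).ne']
  have hv0 : ∀ k, v k * t k ≤ v 0 * t k := fun k =>
    mul_le_mul_of_nonneg_right (hvanti (Nat.zero_le k)) (htpos k).le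
  refine ⟨_, connects_limitPath (P := P) (Q := Q) (τ := totalTime t) (t := t)
    (D := fun k => 2 * ρ k) (R := R)
    (fun k x y h => (hPQ k x y h).1) (fun k x y h => (hPQ k x y h).2.1) htpos
    (fun k => (htpos k).trans_le (le_totalTime htpos hs k)) (totalTime_eq hs) tendsto_totalTime
    (hρsum.mul_left 2) (hρanti.const_mul zero_le_two) hdist ?_ ?_ ?_ 0 x y ⟨S, hS, hx, hy⟩⟩
  · intro k x y h
    have h1 := hdist k x y h
    have h2 : v 0 * t k ≤ v 0 * totalTime t k :=
      mul_le_mul_of_nonneg_left (le_totalTime htpos hs k) (hv 0).le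
    change dist x y ≤ v 0 * totalTime t k
    linarith [hvt k, hv0 k, hρ k]
  · intro k x y h
    change _ ≤ v 0 * t k
    linarith [(hPQ k x y h).2.2.1, hvt k, hv0 k]
  · intro k x y h
    obtain ⟨-, -, h1, m, hm, hp, hq, hvm⟩ := hPQ k x y h
    refine ⟨m, hm, hp, hq, ?_⟩
    have := mul_le_mul_of_nonneg_right hvm (htpos k).le
    linarith [hvt k]

/-! ### Speeds and times at the successive scales -/

/-- The speed of the lines used at level `k`. -/
def levelSpeed (d : ℕ) (γ α κ r L : ℝ) (k : ℕ) : ℝ :=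
  (κ * (r * α⁻¹ ^ (k + 1)) ^ (d - 1) / ((k + 2) * L)) ^ (1 / (γ - 1))

/-- The factor of `r ^ ((γ - d) / (γ - 1))` in the time needed at unit logarithmic rarity. -/
def timeConstant (d : ℕ) (γ α κ : ℝ) : ℝ :=
  4 * κ ^ (-(1 / (γ - 1))) * α ^ ((d - 1) * (1 / (γ - 1))) *
    ∑' k : ℕ, (k + 2 : ℝ) ^ (1 / (γ - 1)) * (2 * α⁻¹ ^ ((γ - d) / (γ - 1))) ^ k

theorem levelSpeed_pos {d : ℕ} {γ α κ r L : ℝ} (hα : 0 < α) (hκ : 0 < κ) (hr : 0 < r) (hL : 0 < L)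
    (k : ℕ) : 0 < levelSpeed d γ α κ r L k := by
  unfold levelSpeed
  positivity

theorem antitone_levelSpeed {d : ℕ} {γ α κ r L : ℝ} (hγ : 1 < γ) (hα : 1 ≤ α) (hκ : 0 < κ)
    (hr : 0 < r) (hL : 0 < L) : Antitone (levelSpeed d γ α κ r L) := by
  refine antitone_nat_of_succ_le fun k => ?_
  unfold levelSpeed
  have : 0 < γ - 1 := by linarith
  have hα1 : α⁻¹ ≤ 1 := inv_le_one_of_one_le₀ hα
  refine Real.rpow_le_rpow (by positivity) ?_ (by positivity)
  have hp : α⁻¹ ^ (k + 1 + 1) ≤ α⁻¹ ^ (k + 1) :=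
    pow_le_pow_of_le_one (by positivity) hα1 (Nat.le_succ _)
  gcongr
  linarith

theorem levelSpeed_rpow {d : ℕ} {γ α κ r L : ℝ} (hγ : 1 < γ) (hα : 0 < α) (hκ : 0 < κ) (hr : 0 < r)
    (hL : 0 < L) (k : ℕ) :
    κ * (r * α⁻¹ ^ (k + 1)) ^ (d - 1) * levelSpeed d γ α κ r L k ^ (1 - γ) = (k + 2) * L := by
  unfold levelSpeed
  have : γ - 1 ≠ 0 := by linarith
  rw [← Real.rpow_mul (by positivity), show 1 / (γ - 1) * (1 - γ) = -1 by field_simp; ring,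
    Real.rpow_neg_one]
  field_simp

theorem levelTime_eq {d : ℕ} (hd : 1 ≤ d) {γ α κ r L : ℝ} (hγ : 1 < γ) (hα : 0 < α) (hκ : 0 < κ)
    (hr : 0 < r) (hL : 0 < L) (k : ℕ) :
    2 ^ k * (4 * (r * α⁻¹ ^ k) / levelSpeed d γ α κ r L k) =
      4 * κ ^ (-(1 / (γ - 1))) * α ^ ((d - 1) * (1 / (γ - 1))) * r ^ ((γ - d) / (γ - 1)) *
        L ^ (1 / (γ - 1)) *
        ((k + 2 : ℝ) ^ (1 / (γ - 1)) * (2 * α⁻¹ ^ ((γ - d) / (γ - 1))) ^ k) := by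
  have hk : (0 : ℝ) < k + 2 := by positivity
  have hg : γ - 1 ≠ 0 := by linarith
  obtain ⟨m, rfl⟩ : ∃ m, d = m + 1 := ⟨d - 1, by omega⟩
  refine Real.log_injOn_pos (mem_Ioi.2 ?_) (mem_Ioi.2 ?_) ?_
  · have := levelSpeed_pos (d := m + 1) (γ := γ) hα hκ hr hL k
    positivity
  · positivity
  have hs := (levelSpeed_pos (d := m + 1) (γ := γ) hα hκ hr hL k).ne'
  rw [Real.log_mul (by positivity) (by positivity), Real.log_div (by positivity) hs,
    Real.log_mul (by positivity) (by positivity), Real.log_mul (by positivity) (by positivity),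
    levelSpeed, Real.log_rpow (by positivity), Real.log_div (by positivity) (by positivity),
    Real.log_mul (by positivity) (by positivity), Real.log_pow, Real.log_pow, Real.log_pow,
    Real.log_mul (by positivity) (by positivity), Real.log_pow, Real.log_inv,
    Real.log_mul (by positivity) (by positivity),
    Real.log_mul (by positivity) (by positivity), Real.log_mul (by positivity) (by positivity),
    Real.log_mul (by positivity) (by positivity), Real.log_mul (by positivity) (by positivity),
    Real.log_mul (by positivity) (by positivity), Real.log_mul (by positivity) (by positivity),
    Real.log_pow, Real.log_mul (by positivity) (by positivity),
    Real.log_rpow (by positivity), Real.log_rpow (by positivity), Real.log_rpow (by positivity),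
    Real.log_rpow (by positivity), Real.log_rpow (by positivity), Real.log_rpow (by positivity),
    Real.log_inv]
  simp only [Nat.add_sub_cancel]
  push_cast
  field_simp
  ring

theorem summable_rpow_mul_geometric {β x : ℝ} (hβ : β ≤ 1) (hx0 : 0 ≤ x) (hx : x < 1) :
    Summable fun k : ℕ => (k + 2 : ℝ) ^ β * x ^ k := by
  have h1 : Summable fun k : ℕ => (k + 2 : ℝ) * x ^ k := by
    have a := summable_pow_mul_geometric_of_norm_lt_one 1
      (show ‖x‖ < 1 by rwa [Real.norm_eq_abs, abs_of_nonneg hx0])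
    have b := (summable_geometric_of_lt_one hx0 hx).mul_left 2
    refine (a.add b).congr fun k => ?_
    rw [pow_one]; ring
  refine Summable.of_nonneg_of_le (fun k => by positivity) (fun k => ?_) h1
  gcongr
  have : (1 : ℝ) ≤ k + 2 := by have : (0 : ℝ) ≤ k := Nat.cast_nonneg k; linarith
  simpa using Real.rpow_le_rpow_of_exponent_le this hβ

theorem two_mul_rpow_lt_one {d : ℕ} {γ α : ℝ} (hγ : 1 < γ) (hdγ : d < γ)
    (hα : (2 : ℝ) ^ ((γ - 1) / (γ - d)) < α) : 2 * α⁻¹ ^ ((γ - d) / (γ - 1)) < 1 := by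
  have h1 : 0 < γ - 1 := by linarith
  have h2 : 0 < γ - d := by linarith
  have hα0 : 0 < α := (Real.rpow_pos_of_pos two_pos _).trans hα
  have := Real.rpow_lt_rpow (by positivity) hα (div_pos h2 h1)
  rw [← Real.rpow_mul (by norm_num), div_mul_div_cancel₀ h2.ne', div_self h1.ne',
    Real.rpow_one] at this
  rw [Real.inv_rpow hα0.le, ← div_eq_mul_inv, div_lt_one (by positivity)]
  exact this

theorem timeConstant_pos {d : ℕ} {γ α κ : ℝ} (hγ : 2 ≤ γ) (hdγ : d < γ) (hκ : 0 < κ)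
    (hα : (2 : ℝ) ^ ((γ - 1) / (γ - d)) < α) : 0 < timeConstant d γ α κ := by
  have hα0 : 0 < α := (Real.rpow_pos_of_pos two_pos _).trans hα
  have hβ : 1 / (γ - 1) ≤ 1 := by
    rw [div_le_one (by linarith)]; linarith
  have hsum := summable_rpow_mul_geometric hβ (x := 2 * α⁻¹ ^ ((γ - d) / (γ - 1)))
    (by positivity) (two_mul_rpow_lt_one (by linarith) hdγ hα)
  refine mul_pos (by positivity) (hsum.tsum_pos (fun k => by positivity) 0 (by positivity))

theorem levelTime_summable_and_total {d : ℕ} (hd : 1 ≤ d) {γ α κ r L : ℝ} (hγ : 2 ≤ γ)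
    (hdγ : d < γ) (hα : (2 : ℝ) ^ ((γ - 1) / (γ - d)) < α) (hκ : 0 < κ) (hr : 0 < r)
    (hL : 0 < L) :
    (Summable fun k : ℕ => 2 ^ k * (4 * (r * α⁻¹ ^ k) / levelSpeed d γ α κ r L k)) ∧
      totalTime (fun k => 4 * (r * α⁻¹ ^ k) / levelSpeed d γ α κ r L k) 0 =
        timeConstant d γ α κ * r ^ ((γ - d) / (γ - 1)) * L ^ (1 / (γ - 1)) := by
  have hα0 : 0 < α := (Real.rpow_pos_of_pos two_pos _).trans hα
  have hβ : 1 / (γ - 1) ≤ 1 := by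
    rw [div_le_one (by linarith)]; linarith
  have hsum := summable_rpow_mul_geometric hβ (x := 2 * α⁻¹ ^ ((γ - d) / (γ - 1)))
    (by positivity) (two_mul_rpow_lt_one (by linarith) hdγ hα)
  constructor
  · simp_rw [levelTime_eq hd (by linarith : 1 < γ) hα0 hκ hr hL]
    exact hsum.mul_left _
  · unfold totalTime
    simp_rw [zero_add, levelTime_eq hd (by linarith : 1 < γ) hα0 hκ hr hL]
    rw [tsum_mul_left, timeConstant]
    ring

/-! ### Upper expectation from tail bounds -/

theorem upperExpectation_exp_lt_top {Ω : Type*} [MeasurableSpace Ω] (P : Measure Ω)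
    [IsProbabilityMeasure P] {X : Ω → ℝ≥0∞} {C c t₀ δ : ℝ} (hC : 0 ≤ C)
    (htail : ∀ t : ℝ, t₀ < t → P {ω | ENNReal.ofReal t < X ω} ≤
      ENNReal.ofReal (C * Real.exp (-(t / c)))) (hδ : δ < 1 / c) :
    upperExpectation P (fun ω => EReal.exp ((δ : EReal) * (X ω : EReal))) < ⊤ := by
  rcases le_or_gt δ 0 with hδ0 | hδ0
  · have hle : (fun ω => EReal.exp ((δ : EReal) * (X ω : EReal))) ≤ fun _ => 1 := by
      intro ω
      have h1 : (δ : EReal) * (X ω : EReal) ≤ 0 :=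
        mul_nonpos_of_nonpos_of_nonneg (by exact_mod_cast hδ0) (EReal.coe_ennreal_nonneg _)
      simpa using EReal.exp_monotone h1
    refine (iInf₂_le (fun _ => 1) ⟨measurable_const, hle⟩).trans_lt ?_
    simp
  obtain ⟨m₀, hm₀⟩ := exists_nat_gt t₀
  let S : ℕ → Set Ω := fun m => toMeasurable P {ω | ENNReal.ofReal (m₀ + m : ℝ) < X ω}
  let g : Ω → ℝ≥0∞ := fun ω => ENNReal.ofReal (Real.exp (δ * m₀)) +
    ∑' m : ℕ, (S m).indicator (fun _ => ENNReal.ofReal (Real.exp (δ * (m₀ + m + 1)))) ω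
  have hSm : ∀ m, MeasurableSet (S m) := fun m => measurableSet_toMeasurable _ _
  have hterm : ∀ m, Measurable
      ((S m).indicator fun _ : Ω => ENNReal.ofReal (Real.exp (δ * (m₀ + m + 1)))) :=
    fun m => measurable_const.indicator (hSm m)
  have hg : Measurable g := measurable_const.add (Measurable.tsum hterm)
  have hexp : ∀ ω, ∀ b : ℝ, X ω ≤ ENNReal.ofReal b → 0 ≤ b →
      EReal.exp ((δ : EReal) * (X ω : EReal)) ≤ ENNReal.ofReal (Real.exp (δ * b)) := by
    intro ω b hb hb0
    have hX : X ω ≠ ∞ := (hb.trans_lt ENNReal.ofReal_lt_top).ne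
    have h1 : (X ω : EReal) = ((X ω).toReal : EReal) := (EReal.coe_ennreal_toReal hX).symm
    rw [h1, ← EReal.coe_mul, EReal.exp_coe]
    apply ENNReal.ofReal_le_ofReal
    apply Real.exp_le_exp.2
    exact mul_le_mul_of_nonneg_left (ENNReal.toReal_le_of_le_ofReal hb0 hb) hδ0.le
  have hfg : (fun ω => EReal.exp ((δ : EReal) * (X ω : EReal))) ≤ g := by
    intro ω
    by_cases htop : X ω = ∞
    · have : ∑' m : ℕ, (S m).indicator
          (fun _ => ENNReal.ofReal (Real.exp (δ * (m₀ + m + 1)))) ω = ∞ := by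
        refine top_le_iff.1 ?_
        rw [← ENNReal.tsum_const_eq_top_of_ne_zero (α := ℕ) (c := 1) one_ne_zero]
        refine ENNReal.tsum_le_tsum fun m => ?_
        rw [indicator_of_mem (subset_toMeasurable _ _ (by simp [htop]))]
        rw [← ENNReal.ofReal_one]
        exact ENNReal.ofReal_le_ofReal (Real.one_le_exp (by positivity))
      simp only [g, this, add_top]
      exact le_top
    by_cases hle : X ω ≤ ENNReal.ofReal m₀
    · exact (hexp ω m₀ hle (Nat.cast_nonneg _)).trans le_self_add
    · rw [not_le] at hle
      have hlt : (m₀ : ℝ) < (X ω).toReal := (ENNReal.ofReal_lt_iff_lt_toReal (Nat.cast_nonneg _) htop).1 hle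
      obtain ⟨m, hm1, hm2⟩ : ∃ m : ℕ, (m₀ + m : ℝ) < (X ω).toReal ∧
          (X ω).toReal ≤ m₀ + m + 1 := by
        have hpos : 0 < (X ω).toReal - m₀ := by linarith
        have hceil := Nat.ceil_pos.2 hpos
        refine ⟨⌈(X ω).toReal - m₀⌉₊ - 1, ?_, ?_⟩
        · have := Nat.ceil_lt_add_one hpos.le
          rw [Nat.cast_sub hceil]; push_cast; linarith
        · have := Nat.le_ceil ((X ω).toReal - m₀)
          rw [Nat.cast_sub hceil]; push_cast; linarith
      refine (hexp ω (m₀ + m + 1) ?_ (by positivity)).trans ?_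
      · rwa [← ENNReal.ofReal_toReal htop, ENNReal.ofReal_le_ofReal_iff (by positivity)]
      · refine le_trans ?_ le_add_self
        refine le_trans ?_ (ENNReal.le_tsum m)
        rw [indicator_of_mem (subset_toMeasurable _ _ ?_)]
        exact (ENNReal.ofReal_lt_iff_lt_toReal (by positivity) htop).2 hm1
  refine (iInf₂_le g ⟨hg, hfg⟩).trans_lt ?_
  rw [lintegral_add_left measurable_const, lintegral_tsum fun m => (hterm m).aemeasurable]
  refine ENNReal.add_lt_top.2 ⟨by simp, ?_⟩
  set x := Real.exp (δ - 1 / c) with hx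
  have hx1 : x < 1 := Real.exp_lt_one_iff.2 (by linarith)
  have hbound : ∀ m : ℕ, ∫⁻ ω, (S m).indicator
      (fun _ => ENNReal.ofReal (Real.exp (δ * (m₀ + m + 1)))) ω ∂P ≤
      ENNReal.ofReal (C * Real.exp (δ * (m₀ + 1) - m₀ / c) * x ^ m) := by
    intro m
    rw [lintegral_indicator_const (hSm m), measure_toMeasurable]
    have hlt : t₀ < m₀ + m := by
      have : (0 : ℝ) ≤ m := Nat.cast_nonneg m
      linarith
    refine (mul_le_mul_right (htail _ hlt) _).trans_eq ?_
    rw [← ENNReal.ofReal_mul (Real.exp_pos _).le]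
    congr 1
    rw [hx, ← Real.exp_nat_mul, mul_left_comm, mul_assoc, ← Real.exp_add, ← Real.exp_add]
    congr 2
    ring
  refine (ENNReal.tsum_le_tsum hbound).trans_lt ?_
  rw [← ENNReal.ofReal_tsum_of_nonneg (fun m => by positivity)
    ((summable_geometric_of_lt_one (Real.exp_pos _).le hx1).mul_left _)]
  exact ENNReal.ofReal_lt_top

/-! ### The connection event -/

theorem cells_subset {d : ℕ} {A : Set (E d)} {S₀ : Finset (Set (E d))}
    {cov : ℕ → Set (E d) → Finset (E d)} {r α : ℝ} (hr : 0 < r) (hα : 1 < α)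
    (hS₀ : ∀ S ∈ S₀, S ⊆ A ∧ ∃ a, S ⊆ Metric.ball a r)
    (hcov : ∀ k S, (∃ a, S ⊆ Metric.ball a (r * α⁻¹ ^ k)) → ∀ b ∈ cov k S, b ∈ S) (k : ℕ) :
    ∀ S ∈ cells S₀ cov (fun k => r * α⁻¹ ^ k) k, (∃ a, S ⊆ Metric.ball a (r * α⁻¹ ^ k)) ∧
      ∀ x ∈ S, ∃ a ∈ A, dist x a ≤ r / (α - 1) * (1 - α⁻¹ ^ k) := by
  have hα1 : α - 1 ≠ 0 := by linarith
  induction k with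
  | zero =>
    intro S hS
    obtain ⟨h1, h2⟩ := hS₀ S hS
    exact ⟨by simpa using h2, fun x hx => ⟨x, h1 hx, by simp⟩⟩
  | succ k ih =>
    intro S' hS'
    obtain ⟨S, hS, b, hb, rfl⟩ := mem_cells_succ.1 hS'
    refine ⟨⟨b, Subset.rfl⟩, fun x hx => ?_⟩
    obtain ⟨a, ha, hba⟩ := (ih S hS).2 b (hcov k S (ih S hS).1 b hb)
    refine ⟨a, ha, (dist_triangle x b a).trans ?_⟩
    have h1 := (Metric.mem_ball.1 hx).le
    have h2 : r / (α - 1) * (1 - α⁻¹ ^ (k + 1)) =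
        r * α⁻¹ ^ (k + 1) + r / (α - 1) * (1 - α⁻¹ ^ k) := by
      have : α ≠ 0 := by linarith
      rw [pow_succ]
      field_simp
      ring
    linarith

/-- The union bound over all levels, cells and pairs of points. -/
theorem measure_iUnion_levels_le {Ω X Y : Type*} [MeasurableSpace Ω] {P : Measure Ω}
    {C : ℕ → Finset X} {t : ℕ → X → Finset Y} {U : ℕ → Y → Y → Set Ω} {n : ℕ} {K ε : ℝ}
    (hK : 0 ≤ K) (hε : 0 ≤ ε) (hKε : K * ε ≤ 1 / 2)
    (hC : ∀ k, ((C k).card : ℝ) ≤ n * K ^ k) (ht : ∀ k, ∀ S ∈ C k, ((t k S).card : ℝ) ≤ K)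
    (hU : ∀ k, ∀ S ∈ C k, ∀ b ∈ t k S, ∀ c ∈ t k S, P (U k b c) ≤ ENNReal.ofReal (ε ^ (k + 2))) :
    P (⋃ k, ⋃ S ∈ C k, ⋃ b ∈ t k S, ⋃ c ∈ t k S, U k b c) ≤ ENNReal.ofReal (2 * n * K * ε) := by
  have hlevel : ∀ k, P (⋃ S ∈ C k, ⋃ b ∈ t k S, ⋃ c ∈ t k S, U k b c) ≤
      ENNReal.ofReal (n * (K * ε) ^ 2 * (K * ε) ^ k) := by
    intro k
    calc P (⋃ S ∈ C k, ⋃ b ∈ t k S, ⋃ c ∈ t k S, U k b c)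
        ≤ ∑ S ∈ C k, ∑ b ∈ t k S, ∑ c ∈ t k S, P (U k b c) := by
          refine (measure_biUnion_finset_le _ _).trans (Finset.sum_le_sum fun S _ => ?_)
          refine (measure_biUnion_finset_le _ _).trans (Finset.sum_le_sum fun b _ => ?_)
          exact measure_biUnion_finset_le _ _
      _ ≤ ∑ S ∈ C k, ∑ b ∈ t k S, ∑ c ∈ t k S, ENNReal.ofReal (ε ^ (k + 2)) :=
          Finset.sum_le_sum fun S hS => Finset.sum_le_sum fun b hb =>
            Finset.sum_le_sum fun c hc => hU k S hS b hb c hc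
      _ ≤ ∑ S ∈ C k, ENNReal.ofReal (K * (K * ε ^ (k + 2))) := by
          refine Finset.sum_le_sum fun S hS => ?_
          rw [Finset.sum_const, Finset.sum_const, nsmul_eq_mul, nsmul_eq_mul,
            ← ENNReal.ofReal_natCast, ← ENNReal.ofReal_mul (by positivity),
            ← ENNReal.ofReal_mul (by positivity)]
          apply ENNReal.ofReal_le_ofReal
          have := ht k S hS
          gcongr
      _ ≤ ENNReal.ofReal ((n * K ^ k) * (K * (K * ε ^ (k + 2)))) := by
          rw [Finset.sum_const, nsmul_eq_mul, ← ENNReal.ofReal_natCast,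
            ← ENNReal.ofReal_mul (by positivity)]
          apply ENNReal.ofReal_le_ofReal
          have := hC k
          gcongr
      _ = _ := by
          congr 1
          rw [mul_pow, mul_pow, pow_add]
          ring
  have hx0 : 0 ≤ K * ε := by positivity
  have hx1 : K * ε < 1 := by linarith
  refine (measure_iUnion_le _).trans ((ENNReal.tsum_le_tsum hlevel).trans ?_)
  rw [← ENNReal.ofReal_tsum_of_nonneg (fun k => by positivity)
    ((summable_geometric_of_lt_one hx0 hx1).mul_left _), tsum_mul_left,
    tsum_geometric_of_lt_one hx0 hx1]
  apply ENNReal.ofReal_le_ofReal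
  rw [← div_eq_mul_inv, div_le_iff₀ (by linarith)]
  have hn : (0 : ℝ) ≤ n := Nat.cast_nonneg n
  nlinarith [mul_nonneg hn hx0]

theorem measure_timeDiam_gt_le {d : ℕ} (hd : 2 ≤ d) {γ α Θ κ : ℝ} (hγ : (d : ℝ) < γ)
    (hα2 : 2 ≤ α) (hα : (2 : ℝ) ^ ((γ - 1) / (γ - d)) < α) (hκ : 0 < κ)
    (hlines : ∀ (ρ : ℝ) (b c : E d) (F : Set (E d)), 0 < ρ → dist b c < 2 * α * ρ →
      NullMeasurableSet (hitting F) (lineMeasure d) →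
      (∀ x ∈ Metric.ball b ρ, solidAngle F x < ENNReal.ofReal Θ) →
      ∃ G : Set (Line d), MeasurableSet G ∧ G ⊆ hitting (Metric.ball b ρ) ∧
        G ⊆ hitting (Metric.ball c ρ) ∧ Disjoint G (hitting F) ∧
        ENNReal.ofReal (κ * ρ ^ (d - 1)) ≤ lineMeasure d G)
    {Ω : Type*} [MeasurableSpace Ω] {P : Measure Ω} [IsProbabilityMeasure P]
    {N : Ω → Set (Line d × ℝ)} (hN : IsPoissonProcess P N (markedLineMeasure d γ))
    {A F : Set (E d)} {r : ℝ} {n : ℕ} (hr : 0 < r) (hA : IsPreconnected A)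
    (hF : NullMeasurableSet (hitting F) (lineMeasure d))
    (hsolid : ∀ x ∈ Metric.thickening (r / (α - 1)) A, solidAngle F x < ENNReal.ofReal Θ)
    {a : Fin n → E d} (ha : A ⊆ ⋃ i, Metric.ball (a i) r) {ε : ℝ} (hε : 0 < ε)
    (hε' : ε < 1 / (2 * n * (2 * α + 1) ^ d)) :
    P {ω | ENNReal.ofReal (n * timeConstant d γ α κ * r ^ ((γ - d) / (γ - 1)) *
            (Real.log (1 / ε)) ^ (1 / (γ - 1))) <
          timeDiam (restrictLines (N ω)
            (hitting (Metric.thickening (r / (α - 1)) A) \ hitting F)) A} ≤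
      ENNReal.ofReal (ε / (1 / (2 * n * (2 * α + 1) ^ d))) := by
  classical
  have hd' : (2 : ℝ) ≤ d := by exact_mod_cast hd
  have hα0 : 0 < α := by linarith
  have hn : 1 ≤ n := by
    rcases Nat.eq_zero_or_pos n with rfl | h
    · simp at hε'; linarith
    · exact h
  have hn' : (1 : ℝ) ≤ n := by exact_mod_cast hn
  set K := (2 * α + 1) ^ d with hK
  have hK1 : 1 ≤ K := one_le_pow₀ (by linarith)
  have hKε : 2 * n * K * ε < 1 := by
    rw [lt_div_iff₀ (by positivity)] at hε'
    linarith
  have hKε2 : K * ε ≤ 1 / 2 := by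
    have : K * ε ≤ n * (K * ε) := le_mul_of_one_le_left (by positivity) hn'
    linarith
  have hε1 : ε < 1 := by nlinarith
  set L := Real.log (1 / ε) with hL
  have hL0 : 0 < L := Real.log_pos (by rw [lt_div_iff₀ hε]; linarith)
  have hLε : ε = Real.exp (-L) := by rw [hL, one_div, Real.log_inv, neg_neg, Real.exp_log hε]
  set ρ : ℕ → ℝ := fun k => r * α⁻¹ ^ k with hρ_def
  have hρ : ∀ k, 0 < ρ k := fun k => by positivity
  have hαinv : α⁻¹ < 1 := inv_lt_one_of_one_lt₀ (by linarith)
  have hρsucc : ∀ k, ρ k = α * ρ (k + 1) := fun k => by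
    simp only [hρ_def, pow_succ]; field_simp
  have hex : ∀ (k : ℕ) (S : Set (E d)), ∃ t : Finset (E d),
      (∃ a, S ⊆ Metric.ball a (ρ k)) → (∀ b ∈ t, b ∈ S) ∧
        (∀ x ∈ S, ∃ b ∈ t, x ∈ Metric.ball b (ρ (k + 1))) ∧ (t.card : ℝ) ≤ K := by
    intro k S
    by_cases h : ∃ a, S ⊆ Metric.ball a (ρ k)
    · obtain ⟨a, ha⟩ := h
      obtain ⟨t, h1, h2, h3⟩ := exists_finset_cover (hρ k) (hρ (k + 1)) ha
      refine ⟨t, fun _ => ⟨h1, h2, ?_⟩⟩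
      rwa [hρsucc k, mul_div_cancel_right₀ _ (hρ (k + 1)).ne'] at h3
    · exact ⟨∅, fun h' => absurd h' h⟩
  choose cov hcov using hex
  let S₀ : Finset (Set (E d)) := Finset.univ.image fun i => A ∩ Metric.ball (a i) r
  have hS₀card : (S₀.card : ℝ) ≤ n := by
    exact_mod_cast Finset.card_image_le.trans_eq (Finset.card_fin n)
  have hcells := cells_subset (A := A) (S₀ := S₀) (cov := cov) hr (by linarith : 1 < α)
    (by
      intro S hS
      obtain ⟨i, -, rfl⟩ := Finset.mem_image.1 hS
      exact ⟨inter_subset_left, _, inter_subset_right⟩)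
    (fun k S h => (hcov k S h).1)
  have hthick : ∀ k, ∀ S ∈ cells S₀ cov ρ k, ∀ b ∈ cov k S,
      Metric.ball b (ρ (k + 1)) ⊆ Metric.thickening (r / (α - 1)) A := by
    intro k S hS b hb x hx
    obtain ⟨y, hy, hxy⟩ := (hcells (k + 1) _ (mem_cells_succ.2 ⟨S, hS, b, hb, rfl⟩)).2 x hx
    refine Metric.mem_thickening_iff.2 ⟨y, hy, hxy.trans_lt ?_⟩
    have h1 : 0 < r / (α - 1) := div_pos hr (by linarith)
    have h2 : 0 < α⁻¹ ^ (k + 1) := by positivity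
    nlinarith
  have hexG : ∀ (k : ℕ) (b c : E d), ∃ G : Set (Line d),
      (∃ S ∈ cells S₀ cov ρ k, b ∈ cov k S ∧ c ∈ cov k S) →
      MeasurableSet G ∧ G ⊆ hitting (Metric.ball b (ρ (k + 1))) ∧
        G ⊆ hitting (Metric.ball c (ρ (k + 1))) ∧ Disjoint G (hitting F) ∧
        ENNReal.ofReal (κ * ρ (k + 1) ^ (d - 1)) ≤ lineMeasure d G := by
    intro k b c
    by_cases h : ∃ S ∈ cells S₀ cov ρ k, b ∈ cov k S ∧ c ∈ cov k S
    · obtain ⟨S, hS, hb, hc⟩ := h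
      obtain ⟨z, hz⟩ := (hcells k S hS).1
      have hSc := (hcov k S ⟨z, hz⟩).1
      obtain ⟨G, hG⟩ := hlines (ρ (k + 1)) b c F (hρ _) (by
          have h1 := Metric.mem_ball.1 (hz (hSc b hb))
          have h2 := Metric.mem_ball'.1 (hz (hSc c hc))
          have h3 := hρsucc k
          change dist b z < ρ k at h1
          change dist z c < ρ k at h2
          linarith [dist_triangle b z c]) hF
        fun x hx => hsolid x (hthick k S hS b hb hx)
      exact ⟨G, fun _ => hG⟩
    · exact ⟨∅, fun h' => absurd h' h⟩
  choose G hG using hexG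
  set v := levelSpeed d γ α κ r L with hv_def
  have hv : ∀ k, 0 < v k := levelSpeed_pos hα0 hκ hr hL0
  let U : ℕ → E d → E d → Set Ω := fun k b c => {ω | ¬ ∃ m ∈ N ω, m.1 ∈ G k b c ∧ v k ≤ m.2}
  have hU : ∀ k, ∀ S ∈ cells S₀ cov ρ k, ∀ b ∈ cov k S, ∀ c ∈ cov k S,
      P (U k b c) ≤ ENNReal.ofReal (ε ^ (k + 2)) := by
    intro k S hS b hb c hc
    obtain ⟨hGm, -, -, -, hGμ⟩ := hG k b c ⟨S, hS, hb, hc⟩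
    refine (hN.measure_no_fast_line_le (by linarith) hGm
      (mul_nonneg hκ.le (pow_nonneg (hρ _).le _)) hGμ (hv k)).trans_eq ?_
    rw [hv_def, levelSpeed_rpow (by linarith) hα0 hκ hr hL0, hLε, ← Real.exp_nat_mul]
    congr 2
    push_cast
    ring
  have hbad := measure_iUnion_levels_le (P := P) (C := cells S₀ cov ρ) (t := cov) (n := n)
    (by positivity : 0 ≤ K) hε.le hKε2
    (fun k => (card_cells_le (fun k S hS => (hcov k S (hcells k S hS).1).2.2) k).trans
      (by gcongr))
    (fun k S hS => (hcov k S (hcells k S hS).1).2.2) hU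
  rw [div_div_eq_mul_div, div_one, mul_comm ε]
  refine (measure_mono ?_).trans hbad
  intro ω hω
  by_contra hgood
  simp only [mem_iUnion, not_exists] at hgood
  obtain ⟨hsum, htot⟩ := levelTime_summable_and_total (d := d) (by omega)
    (by linarith : 2 ≤ γ) hγ hα hκ hr hL0
  rw [mem_ofPred_eq] at hω
  refine absurd hω (not_lt.2 ?_)
  have htot0 : 0 ≤ totalTime (fun k => 4 * (r * α⁻¹ ^ k) / levelSpeed d γ α κ r L k) 0 := by
    rw [htot]
    have := timeConstant_pos (by linarith : 2 ≤ γ) hγ hκ hα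
    positivity
  have hconn := timeDiam_le_of_cover (V := ⟨v 0, (hv 0).le⟩) (Γ := restrictLines (N ω)
      (hitting (Metric.thickening (r / (α - 1)) A) \ hitting F))
    htot0 hA (fun i => Metric.isOpen_ball) ha
    (fun i x hx y hy => exists_connects_of_cells (S₀ := S₀) (cov := cov) (ρ := ρ) hρ
      (antitone_nat_of_succ_le fun k => by
        rw [hρsucc k]; exact le_mul_of_one_le_left (hρ _).le (by linarith))
      ((summable_geometric_of_lt_one (by positivity) hαinv).mul_left r)
      (fun k S hS => (hcells k S hS).1)
      (fun k S hS => (hcov k S (hcells k S hS).1).1)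
      (fun k S hS => (hcov k S (hcells k S hS).1).2.1)
      hv (antitone_levelSpeed (by linarith) (by linarith) hκ hr hL0) (fun k => rfl) hsum
      (by
        intro k S hS b hb c hc
        obtain ⟨-, hGb, hGc, hGF, -⟩ := hG k b c ⟨S, hS, hb, hc⟩
        obtain ⟨m, hm, hmG, hmv⟩ := not_not.1 (hgood k S hS b hb c hc)
        refine ⟨m, ⟨hm, ?_, Set.disjoint_left.1 hGF hmG⟩, hGb hmG, hGc hmG, hmv⟩
        obtain ⟨z, hz, hzb⟩ := hGb hmG
        exact ⟨z, hz, hthick k S hS b hb hzb⟩)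
      (Finset.mem_image_of_mem _ (Finset.mem_univ i)) hx hy)
  refine hconn.trans (ENNReal.ofReal_le_ofReal (le_of_eq ?_))
  rw [htot]
  ring

theorem solidAngle_bound_of_lt {d : ℕ} (hd : 2 ≤ d) {Θ α : ℝ} (hΘ : 0 < Θ) (hα : 0 < α)
    (h : α < Θ ^ (-(1 / ((d : ℝ) - 1))) / 4) : Θ < (4 * α)⁻¹ ^ (d - 1) := by
  have hd' : (2 : ℝ) ≤ d := by exact_mod_cast hd
  have hd1 : (0 : ℝ) < d - 1 := by linarith
  have h1 : 4 * α < Θ ^ (-(1 / ((d : ℝ) - 1))) := by linarith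
  have h2 := Real.rpow_lt_rpow (by positivity) h1 hd1
  rw [← Real.rpow_mul hΘ.le, show -(1 / ((d : ℝ) - 1)) * (d - 1) = -1 by field_simp,
    Real.rpow_neg_one, show (d : ℝ) - 1 = ((d - 1 : ℕ) : ℝ) by
      rw [Nat.cast_sub (by omega)]; simp, Real.rpow_natCast] at h2
  rw [inv_pow]
  exact (lt_inv_comm₀ (by positivity) hΘ).1 h2

theorem exp_tail_of_log_tail {Ω : Type*} [MeasurableSpace Ω] {P : Measure Ω} {X : Ω → ℝ≥0∞}
    {c β ε₀ : ℝ} (hc : 0 < c) (hβ : 0 < β) (hε₀ : 0 < ε₀) (hε₁ : ε₀ ≤ 1)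
    (h : ∀ ε : ℝ, 0 < ε → ε < ε₀ →
      P {ω | ENNReal.ofReal (c * (Real.log (1 / ε)) ^ (1 / β)) < X ω} ≤ ENNReal.ofReal (ε / ε₀))
    (t : ℝ) (ht : c ^ β * Real.log (1 / ε₀) < t) :
    P {ω | ENNReal.ofReal t < X ω ^ β} ≤
      ENNReal.ofReal (1 / ε₀ * Real.exp (-(t / c ^ β))) := by
  have hcβ : 0 < c ^ β := Real.rpow_pos_of_pos hc _
  have h1 : Real.log (1 / ε₀) < t / c ^ β := by rwa [lt_div_iff₀ hcβ, mul_comm]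
  have h0 : 0 ≤ Real.log (1 / ε₀) := Real.log_nonneg (by rwa [le_div_iff₀ hε₀, one_mul])
  have ht0 : 0 < t / c ^ β := h0.trans_lt h1
  have hexp : Real.exp (-(t / c ^ β)) < ε₀ := by
    rw [← Real.lt_log_iff_exp_lt hε₀]
    rw [one_div, Real.log_inv] at h1
    linarith
  have h2 := h _ (Real.exp_pos _) hexp
  rw [one_div (Real.exp _), ← Real.exp_neg, neg_neg, Real.log_exp] at h2
  rw [one_div_mul_eq_div]
  refine (measure_mono ?_).trans h2
  intro ω hω
  rw [mem_ofPred_eq] at hω ⊢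
  have h3 := ENNReal.rpow_lt_rpow hω (inv_pos.2 hβ)
  rw [← ENNReal.rpow_mul, mul_inv_cancel₀ hβ.ne', ENNReal.rpow_one] at h3
  refine lt_of_eq_of_lt ?_ h3
  have htpos : 0 < t := by
    have := mul_pos ht0 hcβ
    rwa [div_mul_cancel₀ _ hcβ.ne'] at this
  rw [ENNReal.ofReal_rpow_of_pos htpos]
  congr 1
  rw [Real.div_rpow htpos.le hcβ.le, ← Real.rpow_mul hc.le, mul_one_div_cancel hβ.ne',
    Real.rpow_one, one_div]
  field_simp

end

theorem mainTheorem4 (d : ℕ) (hd : 2 ≤ d) (γ : ℝ) (hγ : (d : ℝ) < γ)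
    (Θ α : ℝ) (hΘ_pos : 0 < Θ)
    (hΘ : Θ < (4 * (2 : ℝ) ^ ((γ - 1) / (γ - d))) ^ (1 - (d : ℝ)))
    (hα_min : (2 : ℝ) ^ ((γ - 1) / (γ - d)) < α)
    (hα_max : α < Θ ^ (-(1 / ((d : ℝ) - 1))) / 4) :
    ∃ T₁ : ℝ, 0 < T₁ ∧
      ∀ {Ω : Type*} [MeasurableSpace Ω] (P : Measure Ω) [IsProbabilityMeasure P]
        (N : Ω → Set (Line d × ℝ)), IsPoissonProcess P N (markedLineMeasure d γ) →
      ∀ (A F : Set (E d)) (r : ℝ) (n : ℕ), 0 < r →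
        IsPreconnected A →
        NullMeasurableSet (hitting F) (lineMeasure d) →
        (∀ x ∈ Metric.thickening (r / (α - 1)) A, solidAngle F x < ENNReal.ofReal Θ) →
        (∃ c : Fin n → E d, A ⊆ ⋃ i, Metric.ball (c i) r) →
        (∀ ε : ℝ, 0 < ε → ε < 1 / (2 * n * (2 * α + 1) ^ d) →
          P {ω | ENNReal.ofReal (n * T₁ * r ^ ((γ - d) / (γ - 1)) *
                  (Real.log (1 / ε)) ^ (1 / (γ - 1))) <
                timeDiam (restrictLines (N ω)
                  (hitting (Metric.thickening (r / (α - 1)) A) \ hitting F)) A} ≤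
            ENNReal.ofReal (ε / (1 / (2 * n * (2 * α + 1) ^ d)))) ∧
        (∀ δ : ℝ, δ < (n * T₁ * r ^ ((γ - d) / (γ - 1))) ^ (-(γ - 1)) →
          upperExpectation P (fun ω => EReal.exp ((δ : EReal) *
            ((timeDiam (restrictLines (N ω)
              (hitting (Metric.thickening (r / (α - 1)) A) \ hitting F)) A ^ (γ - 1) : ℝ≥0∞) :
                EReal))) < ⊤) := by
  have hd' : (2 : ℝ) ≤ d := by exact_mod_cast hd
  have hα2 : 2 ≤ α := by
    refine le_trans ?_ hα_min.le
    have h1 : 1 ≤ (γ - 1) / (γ - d) := by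
      rw [le_div_iff₀ (by linarith)]; linarith
    simpa using Real.rpow_le_rpow_of_exponent_le one_le_two h1
  obtain ⟨κ, hκ, hlines⟩ := exists_measurableSet_lines_avoiding hd hα2 hΘ_pos
    (solidAngle_bound_of_lt hd hΘ_pos (by linarith) hα_max)
  have hT := timeConstant_pos (by linarith : 2 ≤ γ) hγ hκ hα_min
  refine ⟨timeConstant d γ α κ, hT, ?_⟩
  intro Ω _ P _ N hN A F r n hr hA hF hsolid ⟨a, ha⟩
  have part1 := fun ε (hε : 0 < ε) hε' =>
    measure_timeDiam_gt_le hd hγ hα2 hα_min hκ hlines hN hr hA hF hsolid ha (ε := ε) hε hε'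
  refine ⟨part1, fun δ hδ => ?_⟩
  rcases Nat.eq_zero_or_pos n with rfl | hn
  · have hA0 : A = ∅ := by
      rw [eq_empty_iff_forall_notMem]
      intro x hx
      obtain ⟨i, -⟩ := mem_iUnion.1 (ha hx)
      exact i.elim0
    have h0 : ∀ Γ : Set (Line d × ℝ), timeDiam Γ A ^ (γ - 1) = 0 := by
      intro Γ
      simp [timeDiam, hA0, ENNReal.zero_rpow_of_pos (by linarith : 0 < γ - 1)]
    simp only [h0]
    refine (iInf₂_le (fun _ => 1) ⟨measurable_const, fun ω => by simp⟩).trans_lt ?_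
    simp
  have hn' : (1 : ℝ) ≤ n := by exact_mod_cast hn
  have hc : 0 < n * timeConstant d γ α κ * r ^ ((γ - d) / (γ - 1)) := by positivity
  have hK : (1 : ℝ) ≤ (2 * α + 1) ^ d := one_le_pow₀ (by linarith)
  refine upperExpectation_exp_lt_top P (by positivity)
    (exp_tail_of_log_tail hc (by linarith : 0 < γ - 1)
      (ε₀ := 1 / (2 * n * (2 * α + 1) ^ d)) (by positivity) ?_ part1) ?_
  · rw [div_le_one (by positivity)]
    nlinarith
  · rwa [one_div, ← Real.rpow_neg hc.le]
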